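/- All algebras are unital over $\mathbb C$; Sweedler notation is used, and $S,\varepsilon,\Delta$ denote antipode, counit and coproduct. Let $H$ and $K$ be Hopf algebras, let $\pi\colon H\to K$ be a map of Hopf algebras, and let $R\colon K\otimes K\to\mathbb C$ be a coquasitriangular structure on $K$, i.e. a linear form with convolution inverse $R^{-1}$ such that for all $x,y,z\in K$ \[R(xy,z)=R(x,z_{(1)})R(y,z_{(2)}),\quad R(x,yz)=R(x_{(1)},z)R(x_{(2)},y),\quad y_{(1)}x_{(1)}R(x_{(2)},y_{(2)})=R(x_{(1)},y_{(1)})x_{(2)}y_{(2)}.\] The category of right $K$-comodules is braided by $m\otimes n\mapsto R(m^{(2)},n^{(2)})\,n^{(1)}\otimes m^{(1)}$, where $m\mapsto m^{(1)}\otimes m^{(2)}$ denotes a coaction. The transmutation $H_R$ is the coalgebra $H$ with its unit, the product \[x\cdot_R y=x_{(2)}y_{(3)}\,R(\pi(x_{(3)}),\pi(S(y_{(1)})))\,R(\pi(x_{(1)}),\pi(y_{(2)})),\] the antipode $S_R(x)=S(x_{(2)})\,R(\pi(S^2(x_{(3)})S(x_{(1)})),\pi(x_{(4)}))$ and the right $K$-coaction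 $\mathrm{ad}_\pi(x)=x_{(2)}\otimes\pi(S(x_{(1)})x_{(3)})$. The bosonization $K\# A$ of a braided Hopf algebra $A$ over $(K,R)$ is the space $K\otimes A$ with unit $1\# 1$, counit $\varepsilon_K\otimes\varepsilon_A$, product $(k\# a)(k'\# a')=R(a^{(2)},k'_{(2)})\,kk'_{(1)}\# a^{(1)}a'$, coproduct \[\Delta(k\# a)=(k_{(1)}\#{a_{(1)}}^{(1)})\otimes(k_{(2)}{a_{(1)}}^{(2)}\# a_{(2)})\] and antipode $S(k\# a)=(1\# S_A(a^{(1)}))(S_K(ka^{(2)})\# 1)$. Let $K\bowtie_R H$ be the tensor product coalgebra $K\otimes H$ with unit $1\otimes 1$ and the product \[(k\otimes h)\cdot(k'\otimes h')=R^{-1}(\pi(h_{(1)}),k'_{(1)})\;kk'_{(2)}\otimes h_{(2)}h'\;R(\pi(h_{(3)}),k'_{(3)}).\] **Theorem.** $H_R$ is a braided Hopf algebra over $(K,R)$ (a Hopf algebra in the braided category of right $K$-comodules), its bosonization $K\# H_R$ is a Hopf algebra, $K\bowtie_R H$ is a Hopf algebra (it has an antipode), and the map \[K\bowtie_R H\to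 K\# H_R,\qquad k\otimes h\mapsto k\pi(h_{(1)})\# h_{(2)},\] is an isomorphism of Hopf algebras. -/

import Mathlib

open TensorProduct

noncomputable section

/-! ### Tensor helpers -/

section Helpers

variable {k : Type*} [CommRing k]

/-- `x ↦ x₍₁₎ ⊗ x₍₂₎ ⊗ x₍₃₎`. -/
def comul₃ (k C : Type*) [CommRing k] [AddCommGroup C] [Module k C] [Coalgebra k C] :
    C →ₗ[k] C ⊗[k] (C ⊗[k] C) :=
  (Coalgebra.comul (R := k) (A := C)).lTensor C ∘ₗ Coalgebra.comul

/-- `x ↦ x₍₁₎ ⊗ x₍₂₎ ⊗ x₍₃₎ ⊗ x₍₄₎`. -/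
def comul₄ (k C : Type*) [CommRing k] [AddCommGroup C] [Module k C] [Coalgebra k C] :
    C →ₗ[k] C ⊗[k] (C ⊗[k] (C ⊗[k] C)) :=
  (comul₃ k C).lTensor C ∘ₗ Coalgebra.comul

variable {V W : Type*} [AddCommGroup V] [Module k V] [AddCommGroup W] [Module k W]

/-- The product `(v ⊗ w)(v' ⊗ w') = v τ(w ⊗ v') w'` on `V ⊗ W` attached to products on `V` and
`W` and an exchange map `τ : W ⊗ V → V ⊗ W`; that is, `(m_V ⊗ m_W)(id ⊗ τ ⊗ id)`. -/
def crossedMul (mV : V ⊗[k] V →ₗ[k] V) (mW : W ⊗[k] W →ₗ[k] W) (τ : W ⊗[k] V →ₗ[k] V ⊗[k] W) :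
    (V ⊗[k] W) ⊗[k] (V ⊗[k] W) →ₗ[k] V ⊗[k] W :=
  TensorProduct.map mV mW ∘ₗ
    (TensorProduct.assoc k V V (W ⊗[k] W)).symm.toLinearMap ∘ₗ
    ((TensorProduct.assoc k V W W).toLinearMap ∘ₗ τ.rTensor W ∘ₗ
      (TensorProduct.assoc k W V W).symm.toLinearMap).lTensor V ∘ₗ
    (TensorProduct.assoc k V W (V ⊗[k] W)).toLinearMap

theorem crossedMul_tmul (mV : V ⊗[k] V →ₗ[k] V) (mW : W ⊗[k] W →ₗ[k] W)
    (τ : W ⊗[k] V →ₗ[k] V ⊗[k] W) (v v' : V) (w w' : W) :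
    crossedMul mV mW τ ((v ⊗ₜ w) ⊗ₜ (v' ⊗ₜ w')) =
      TensorProduct.map (mV ∘ₗ TensorProduct.mk k V V v)
        (mW ∘ₗ (TensorProduct.mk k W W).flip w') (τ (w ⊗ₜ v')) := by
  simp only [crossedMul, LinearMap.comp_apply, LinearEquiv.coe_coe, TensorProduct.assoc_tmul,
    LinearMap.lTensor_tmul, TensorProduct.assoc_symm_tmul, LinearMap.rTensor_tmul]
  induction τ (w ⊗ₜ[k] v') using TensorProduct.induction_on with
  | zero => simp
  | tmul a b => simp
  | add a b ha hb => simp only [TensorProduct.add_tmul, TensorProduct.tmul_add, map_add, ha, hb]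

end Helpers

/-! ### Hopf algebra data and axioms -/

/-- The structure maps of a Hopf algebra on a module, without axioms. -/
structure HopfData (k V : Type*) [CommRing k] [AddCommGroup V] [Module k V] where
  mul : V ⊗[k] V →ₗ[k] V
  one : V
  comul : V →ₗ[k] V ⊗[k] V
  counit : V →ₗ[k] k
  antipode : V →ₗ[k] V

namespace HopfData

variable {k V : Type*} [CommRing k] [AddCommGroup V] [Module k V]

/-- The Hopf algebra axioms, where the product on `V ⊗ V` for which the coproduct is multiplicative
is `(a ⊗ b)(a' ⊗ b') = a τ(b ⊗ a') b'`. -/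
structure IsHopfFor (D : HopfData k V) (τ : V ⊗[k] V →ₗ[k] V ⊗[k] V) : Prop where
  mul_assoc : ∀ a b c, D.mul (D.mul (a ⊗ₜ b) ⊗ₜ c) = D.mul (a ⊗ₜ D.mul (b ⊗ₜ c))
  one_mul : ∀ a, D.mul (D.one ⊗ₜ a) = a
  mul_one : ∀ a, D.mul (a ⊗ₜ D.one) = a
  coassoc : ∀ a, TensorProduct.assoc k V V V (D.comul.rTensor V (D.comul a)) =
    D.comul.lTensor V (D.comul a)
  counit_comul : ∀ a, D.counit.rTensor V (D.comul a) = 1 ⊗ₜ a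
  comul_counit : ∀ a, D.counit.lTensor V (D.comul a) = a ⊗ₜ 1
  comul_mul : ∀ a b, D.comul (D.mul (a ⊗ₜ b)) =
    crossedMul D.mul D.mul τ (D.comul a ⊗ₜ D.comul b)
  comul_one : D.comul D.one = D.one ⊗ₜ D.one
  counit_mul : ∀ a b, D.counit (D.mul (a ⊗ₜ b)) = D.counit a * D.counit b
  counit_one : D.counit D.one = 1
  antipode_left : ∀ a, D.mul (D.antipode.rTensor V (D.comul a)) = D.counit a • D.one
  antipode_right : ∀ a, D.mul (D.antipode.lTensor V (D.comul a)) = D.counit a • D.one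

/-- The axioms of an ordinary Hopf algebra: the exchange map is the flip. -/
def IsHopf (D : HopfData k V) : Prop :=
  D.IsHopfFor (TensorProduct.comm k V V).toLinearMap

/-- The module `V` regarded as a Hopf algebra through data `D` that satisfy the axioms. -/
def Carrier (D : HopfData k V) (_h : D.IsHopf) : Type _ := V

variable (D : HopfData k V) (h : D.IsHopf)

instance : AddCommGroup (D.Carrier h) := inferInstanceAs (AddCommGroup V)
instance : Module k (D.Carrier h) := inferInstanceAs (Module k V)

/-- The identity map from `V` to the Hopf algebra that it carries. -/
def toCarrier : V ≃ₗ[k] D.Carrier h := LinearEquiv.refl k V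

instance : Ring (D.Carrier h) :=
  { (inferInstance : AddCommGroup (D.Carrier h)) with
    mul := fun a b => D.mul ((show V from a) ⊗ₜ[k] (show V from b))
    one := D.one
    left_distrib := fun a b c =>
      (congrArg D.mul (TensorProduct.tmul_add (R := k) (M := V) (N := V) a b c)).trans
        (map_add D.mul _ _)
    right_distrib := fun a b c =>
      (congrArg D.mul (TensorProduct.add_tmul (R := k) (M := V) (N := V) a b c)).trans
        (map_add D.mul _ _)
    zero_mul := fun a =>
      (congrArg D.mul (TensorProduct.zero_tmul (R := k) V (show V from a))).trans (map_zero D.mul)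
    mul_zero := fun a =>
      (congrArg D.mul (TensorProduct.tmul_zero (R := k) V (show V from a))).trans (map_zero D.mul)
    mul_assoc := h.mul_assoc
    one_mul := h.one_mul
    mul_one := h.mul_one }

theorem toCarrier_mul (a b : V) :
    D.toCarrier h (D.mul (a ⊗ₜ b)) = D.toCarrier h a * D.toCarrier h b := rfl

theorem toCarrier_one : D.toCarrier h D.one = 1 := rfl

instance : Algebra k (D.Carrier h) :=
  Algebra.ofModule
    (fun r a b =>
      (congrArg D.mul (TensorProduct.smul_tmul' (R := k) (M := V) (N := V) r a b).symm).trans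
        (map_smul D.mul r _))
    (fun r a b =>
      (congrArg D.mul (TensorProduct.tmul_smul (R := k) (M := V) (N := V) r a b)).trans
        (map_smul D.mul r _))

instance : Coalgebra k (D.Carrier h) where
  comul := D.comul
  counit := D.counit
  coassoc := LinearMap.ext h.coassoc
  rTensor_counit_comp_comul := LinearMap.ext h.counit_comul
  lTensor_counit_comp_comul := LinearMap.ext h.comul_counit

theorem crossedMul_comm (x y : D.Carrier h ⊗[k] D.Carrier h) :
    (crossedMul D.mul D.mul (TensorProduct.comm k V V).toLinearMap
      ((show V ⊗[k] V from x) ⊗ₜ[k] (show V ⊗[k] V from y)) : V ⊗[k] V) = x * y := by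
  induction x using TensorProduct.induction_on with
  | zero =>
    rw [zero_mul]
    exact (congrArg _ (TensorProduct.zero_tmul (R := k) (V ⊗[k] V) (show V ⊗[k] V from y))).trans
      (map_zero _)
  | add x x' hx hx' =>
    rw [add_mul, ← hx, ← hx']
    exact (congrArg _ (TensorProduct.add_tmul (R := k) (M := V ⊗[k] V) (N := V ⊗[k] V) x x' y)).trans
      (map_add _ _ _)
  | tmul a b =>
    induction y using TensorProduct.induction_on with
    | zero =>
      rw [mul_zero]
      exact (congrArg _ (TensorProduct.tmul_zero (R := k) (V ⊗[k] V) (_ : V ⊗[k] V))).trans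
        (map_zero _)
    | add y y' hy hy' =>
      rw [mul_add, ← hy, ← hy']
      exact (congrArg _ (TensorProduct.tmul_add (R := k) (M := V ⊗[k] V) (N := V ⊗[k] V) _ y y')).trans
        (map_add _ _ _)
    | tmul a' b' =>
      rw [Algebra.TensorProduct.tmul_mul_tmul]
      exact crossedMul_tmul (k := k) (V := V) (W := V) D.mul D.mul _ a a' b b'

instance : Bialgebra k (D.Carrier h) :=
  Bialgebra.mk' k (D.Carrier h) h.counit_one (fun {a b} => h.counit_mul a b) h.comul_one
    (fun {a b} => (h.comul_mul a b).trans (D.crossedMul_comm h _ _))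

theorem mul'_carrier (x : V ⊗[k] V) :
    LinearMap.mul' k (D.Carrier h) (show D.Carrier h ⊗[k] D.Carrier h from x) = D.mul x := by
  induction x using TensorProduct.induction_on with
  | zero => exact (map_zero (LinearMap.mul' k (D.Carrier h))).trans (map_zero D.mul).symm
  | add x y hx hy =>
    rw [map_add, ← hx, ← hy]
    exact map_add (LinearMap.mul' k (D.Carrier h)) _ _
  | tmul a b => rfl

instance : HopfAlgebra k (D.Carrier h) where
  antipode := D.antipode
  mul_antipode_rTensor_comul := LinearMap.ext fun a =>
    ((D.mul'_carrier h _).trans (h.antipode_left a)).trans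
      (Algebra.algebraMap_eq_smul_one (A := D.Carrier h) _).symm
  mul_antipode_lTensor_comul := LinearMap.ext fun a =>
    ((D.mul'_carrier h _).trans (h.antipode_right a)).trans
      (Algebra.algebraMap_eq_smul_one (A := D.Carrier h) _).symm

end HopfData

/-! ### Coquasitriangular structures, comodules and the braiding -/

/-- A coquasitriangular structure on a Hopf algebra `K`: a convolution invertible form `R` with
`R(xy, z) = R(x, z₍₁₎) R(y, z₍₂₎)`, `R(x, yz) = R(x₍₁₎, z) R(x₍₂₎, y)` and
`y₍₁₎ x₍₁₎ R(x₍₂₎, y₍₂₎) = R(x₍₁₎, y₍₁₎) x₍₂₎ y₍₂₎`. Its convolution inverse, which is unique, is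
recorded as `inv`. -/
structure Coquasitriangular (k K : Type*) [CommRing k] [Ring K] [HopfAlgebra k K] where
  form : K ⊗[k] K →ₗ[k] k
  inv : K ⊗[k] K →ₗ[k] k
  form_mul_inv : WithConv.toConv form * WithConv.toConv inv = 1
  inv_mul_form : WithConv.toConv inv * WithConv.toConv form = 1
  mul_left : ∀ x y z : K, form ((x * y) ⊗ₜ z) =
    LinearMap.mul' k k (TensorProduct.map (TensorProduct.curry form x) (TensorProduct.curry form y)
      (Coalgebra.comul z))
  mul_right : ∀ x y z : K, form (x ⊗ₜ (y * z)) =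
    LinearMap.mul' k k (TensorProduct.map ((TensorProduct.curry form).flip z)
      ((TensorProduct.curry form).flip y) (Coalgebra.comul x))
  /-- an identity in the convolution algebra of linear maps `K ⊗ K → K` -/
  comm : WithConv.toConv (LinearMap.mul' k K ∘ₗ (TensorProduct.comm k K K).toLinearMap) *
      WithConv.toConv (Algebra.linearMap k K ∘ₗ form) =
    WithConv.toConv (Algebra.linearMap k K ∘ₗ form) * WithConv.toConv (LinearMap.mul' k K)

section Comodules

variable {k K : Type*} [CommRing k] [Ring K] [HopfAlgebra k K]
variable {M N : Type*} [AddCommGroup M] [Module k M] [AddCommGroup N] [Module k N]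

/-- `δ` is a right coaction of `K` on `M`. -/
structure IsRightCoaction (δ : M →ₗ[k] M ⊗[k] K) : Prop where
  coassoc : ∀ m, TensorProduct.assoc k M K K (δ.rTensor K (δ m)) =
    (Coalgebra.comul (R := k) (A := K)).lTensor M (δ m)
  counit : ∀ m, (Coalgebra.counit (R := k) (A := K)).lTensor M (δ m) = m ⊗ₜ 1

/-- The tensor product coaction `m ⊗ n ↦ (m⁽¹⁾ ⊗ n⁽¹⁾) ⊗ m⁽²⁾ n⁽²⁾`. -/
def tensorCoaction (δM : M →ₗ[k] M ⊗[k] K) (δN : N →ₗ[k] N ⊗[k] K) :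
    M ⊗[k] N →ₗ[k] (M ⊗[k] N) ⊗[k] K :=
  (LinearMap.mul' k K).lTensor (M ⊗[k] N) ∘ₗ
    (TensorProduct.tensorTensorTensorComm k M K N K).toLinearMap ∘ₗ TensorProduct.map δM δN

/-- The braiding `m ⊗ n ↦ R(m⁽²⁾, n⁽²⁾) n⁽¹⁾ ⊗ m⁽¹⁾`. -/
def Coquasitriangular.braiding (R : Coquasitriangular k K) (δM : M →ₗ[k] M ⊗[k] K)
    (δN : N →ₗ[k] N ⊗[k] K) : M ⊗[k] N →ₗ[k] N ⊗[k] M :=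
  (TensorProduct.comm k M N).toLinearMap ∘ₗ (TensorProduct.rid k (M ⊗[k] N)).toLinearMap ∘ₗ
    R.form.lTensor (M ⊗[k] N) ∘ₗ
    (TensorProduct.tensorTensorTensorComm k M K N K).toLinearMap ∘ₗ TensorProduct.map δM δN

end Comodules

/-! ### Braided Hopf algebras and their bosonization -/

/-- The structure maps of a braided Hopf algebra over `K`, without axioms. -/
structure BraidedHopfData (k K A : Type*) [CommRing k] [Ring K] [HopfAlgebra k K]
    [AddCommGroup A] [Module k A] extends HopfData k A where
  coact : A →ₗ[k] A ⊗[k] K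

namespace BraidedHopfData

variable {k K A : Type*} [CommRing k] [Ring K] [HopfAlgebra k K] [AddCommGroup A] [Module k A]

/-- `D` is a Hopf algebra in the braided monoidal category of right `K`-comodules, with the braiding
defined by `R`: it is a `K`-comodule, all structure maps are comodule maps, and the Hopf algebra
axioms hold for the product of `A ⊗_R A`. -/
structure IsBraidedHopf (D : BraidedHopfData k K A) (R : Coquasitriangular k K) : Prop where
  isRightCoaction : IsRightCoaction D.coact
  coact_mul : ∀ x, D.coact (D.mul x) = D.mul.rTensor K (tensorCoaction D.coact D.coact x)
  coact_one : D.coact D.one = D.one ⊗ₜ 1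
  coact_comul : ∀ a, tensorCoaction D.coact D.coact (D.comul a) = D.comul.rTensor K (D.coact a)
  coact_counit : ∀ a, D.counit.rTensor K (D.coact a) = D.counit a ⊗ₜ 1
  coact_antipode : ∀ a, D.coact (D.antipode a) = D.antipode.rTensor K (D.coact a)
  isHopfFor : D.IsHopfFor (R.braiding D.coact D.coact)

/-- `(h ⊗ h') ⊗ ((a ⊗ x) ⊗ a') ↦ (h ⊗ a) ⊗ (h' x ⊗ a')` -/
def cosmash (k K A : Type*) [CommRing k] [Ring K] [HopfAlgebra k K] [AddCommGroup A] [Module k A] :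
    (K ⊗[k] K) ⊗[k] ((A ⊗[k] K) ⊗[k] A) →ₗ[k] (K ⊗[k] A) ⊗[k] (K ⊗[k] A) :=
  (((LinearMap.mul' k K).rTensor A ∘ₗ
    (TensorProduct.assoc k K K A).symm.toLinearMap).lTensor (K ⊗[k] A)) ∘ₗ
    (TensorProduct.tensorTensorTensorComm k K K A (K ⊗[k] A)).toLinearMap ∘ₗ
    (TensorProduct.assoc k A K A).toLinearMap.lTensor (K ⊗[k] K)

theorem cosmash_tmul (h h' x : K) (a a' : A) :
    cosmash k K A ((h ⊗ₜ h') ⊗ₜ ((a ⊗ₜ x) ⊗ₜ a')) = (h ⊗ₜ a) ⊗ₜ ((h' * x) ⊗ₜ a') := by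
  simp [cosmash]

/-- The product `(h # a)(h' # a') = R(a⁽²⁾, h'₍₂₎) h h'₍₁₎ # a⁽¹⁾ a'` of the smash product
`K # A = K ⊗_R A`. -/
def smashMul (D : BraidedHopfData k K A) (R : Coquasitriangular k K) :
    (K ⊗[k] A) ⊗[k] (K ⊗[k] A) →ₗ[k] K ⊗[k] A :=
  crossedMul (LinearMap.mul' k K) D.mul (R.braiding D.coact (Coalgebra.comul (R := k) (A := K)))

/-- The bosonization `K # A`: coproduct
`h # a ↦ (h₍₁₎ # a₍₁₎⁽¹⁾) ⊗ (h₍₂₎ a₍₁₎⁽²⁾ # a₍₂₎)` and antipode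
`h # a ↦ (1 # S_A(a⁽¹⁾)) (S_K(h a⁽²⁾) # 1)`. -/
def bosonization (D : BraidedHopfData k K A) (R : Coquasitriangular k K) :
    HopfData k (K ⊗[k] A) where
  mul := D.smashMul R
  one := 1 ⊗ₜ D.one
  comul := cosmash k K A ∘ₗ
    TensorProduct.map (Coalgebra.comul (R := k) (A := K)) (D.coact.rTensor A ∘ₗ D.comul)
  counit := LinearMap.mul' k k ∘ₗ
    TensorProduct.map (Coalgebra.counit (R := k) (A := K)) D.counit
  antipode := D.smashMul R ∘ₗ
    TensorProduct.map
      (TensorProduct.mk k K A 1 ∘ₗ D.antipode)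
      ((TensorProduct.mk k K A).flip D.one ∘ₗ HopfAlgebra.antipode k ∘ₗ LinearMap.mul' k K) ∘ₗ
    (TensorProduct.leftComm k K A K).toLinearMap ∘ₗ D.coact.lTensor K

end BraidedHopfData

/-! ### Transmutation and the twisted tensor product -/

section Transmutation

variable {k K H : Type*} [CommRing k] [Ring K] [HopfAlgebra k K] [Ring H] [HopfAlgebra k H]

/-- `a ⊗ b ⊗ c ↦ b ⊗ π(S(a) c)` -/
def adKernel (π : H →ₐc[k] K) : H ⊗[k] (H ⊗[k] H) →ₗ[k] H ⊗[k] K :=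
  ((π : H →ₗ[k] K) ∘ₗ LinearMap.mul' k H ∘ₗ (HopfAlgebra.antipode k).rTensor H).lTensor H ∘ₗ
    (TensorProduct.leftComm k H H H).toLinearMap

theorem adKernel_tmul (π : H →ₐc[k] K) (a b c : H) :
    adKernel π (a ⊗ₜ (b ⊗ₜ c)) = b ⊗ₜ π (HopfAlgebra.antipode k a * c) := by
  simp [adKernel]

/-- The restricted adjoint coaction `ad_π(x) = x₍₂₎ ⊗ π(S(x₍₁₎) x₍₃₎)`. -/
def adCoaction (π : H →ₐc[k] K) : H →ₗ[k] H ⊗[k] K :=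
  adKernel π ∘ₗ comul₃ k H

/-- `(a ⊗ b ⊗ c) ⊗ (d ⊗ e ⊗ f) ↦ R(π(c), π(S(d))) R(π(a), π(e)) b f` -/
def transmutationMulKernel (π : H →ₐc[k] K) (R : Coquasitriangular k K) :
    (H ⊗[k] (H ⊗[k] H)) ⊗[k] (H ⊗[k] (H ⊗[k] H)) →ₗ[k] H :=
  let r : H ⊗[k] H →ₗ[k] k := R.form ∘ₗ TensorProduct.map (π : H →ₗ[k] K) (π : H →ₗ[k] K)
  (TensorProduct.lid k H).toLinearMap ∘ₗ
    TensorProduct.map r ((TensorProduct.rid k H).toLinearMap ∘ₗ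
      TensorProduct.map (LinearMap.mul' k H) (r ∘ₗ (HopfAlgebra.antipode k).lTensor H) ∘ₗ
      (TensorProduct.tensorTensorTensorComm k H H H H).toLinearMap) ∘ₗ
    (TensorProduct.tensorTensorTensorComm k H (H ⊗[k] H) H (H ⊗[k] H)).toLinearMap ∘ₗ
    ((TensorProduct.assoc k H H H).toLinearMap ∘ₗ
      (TensorProduct.comm k H (H ⊗[k] H)).toLinearMap).lTensor (H ⊗[k] (H ⊗[k] H))

theorem transmutationMulKernel_tmul (π : H →ₐc[k] K) (R : Coquasitriangular k K)
    (a b c d e f : H) :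
    transmutationMulKernel π R ((a ⊗ₜ (b ⊗ₜ c)) ⊗ₜ (d ⊗ₜ (e ⊗ₜ f))) =
      (R.form (π c ⊗ₜ π (HopfAlgebra.antipode k d)) * R.form (π a ⊗ₜ π e)) • (b * f) := by
  simp only [transmutationMulKernel, LinearMap.comp_apply, LinearEquiv.coe_coe,
    LinearMap.lTensor_tmul, TensorProduct.comm_tmul, TensorProduct.assoc_tmul,
    TensorProduct.tensorTensorTensorComm_tmul, TensorProduct.map_tmul, TensorProduct.rid_tmul,
    TensorProduct.lid_tmul, LinearMap.mul'_apply, smul_smul]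
  rw [mul_comm]
  rfl

/-- `a ⊗ b ⊗ c ⊗ d ↦ R(π(S²(c) S(a)), π(d)) S(b)` -/
def transmutationAntipodeKernel (π : H →ₐc[k] K) (R : Coquasitriangular k K) :
    H ⊗[k] (H ⊗[k] (H ⊗[k] H)) →ₗ[k] H :=
  let S : H →ₗ[k] H := HopfAlgebra.antipode k
  let r : H ⊗[k] H →ₗ[k] k := R.form ∘ₗ TensorProduct.map (π : H →ₗ[k] K) (π : H →ₗ[k] K)
  (TensorProduct.rid k H).toLinearMap ∘ₗ
    TensorProduct.map S
      (r ∘ₗ (LinearMap.mul' k H ∘ₗ TensorProduct.map (S ∘ₗ S) S ∘ₗ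
          (TensorProduct.comm k H H).toLinearMap).rTensor H ∘ₗ
        (TensorProduct.assoc k H H H).symm.toLinearMap) ∘ₗ
    (TensorProduct.leftComm k H H (H ⊗[k] H)).toLinearMap

theorem transmutationAntipodeKernel_tmul (π : H →ₐc[k] K) (R : Coquasitriangular k K)
    (a b c d : H) :
    transmutationAntipodeKernel π R (a ⊗ₜ (b ⊗ₜ (c ⊗ₜ d))) =
      R.form (π (HopfAlgebra.antipode k (HopfAlgebra.antipode k c) * HopfAlgebra.antipode k a) ⊗ₜ
        π d) • HopfAlgebra.antipode k b := by
  simp [transmutationAntipodeKernel]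

/-- The transmutation `H_R` of `H` along `π : H → K`: the coalgebra `H` with product
`x ·_R y = x₍₂₎ y₍₃₎ R(π(x₍₃₎), π(S(y₍₁₎))) R(π(x₍₁₎), π(y₍₂₎))`, antipode
`S_R(x) = S(x₍₂₎) R(π(S²(x₍₃₎) S(x₍₁₎)), π(x₍₄₎))` and coaction `ad_π`. -/
def transmutation (π : H →ₐc[k] K) (R : Coquasitriangular k K) : BraidedHopfData k K H where
  mul := transmutationMulKernel π R ∘ₗ TensorProduct.map (comul₃ k H) (comul₃ k H)
  one := 1
  comul := Coalgebra.comul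
  counit := Coalgebra.counit
  antipode := transmutationAntipodeKernel π R ∘ₗ comul₄ k H
  coact := adCoaction π

/-- `h ⊗ k' ↦ R⁻¹(π(h₍₁₎), k'₍₁₎) k'₍₂₎ ⊗ h₍₂₎ R(π(h₍₃₎), k'₍₃₎)`, written as a convolution product of
three linear maps from the coalgebra `H ⊗ K` to the algebra `K ⊗ H`. -/
def bowtieExchange (π : H →ₐc[k] K) (R : Coquasitriangular k K) :
    H ⊗[k] K →ₗ[k] K ⊗[k] H :=
  (WithConv.toConv (Algebra.linearMap k (K ⊗[k] H) ∘ₗ R.inv ∘ₗ (π : H →ₗ[k] K).rTensor K) *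
    WithConv.toConv (TensorProduct.comm k H K).toLinearMap *
    WithConv.toConv
      (Algebra.linearMap k (K ⊗[k] H) ∘ₗ R.form ∘ₗ (π : H →ₗ[k] K).rTensor K)).ofConv

/-- `K ⋈_R H` with a given candidate `S` for the antipode: the tensor product coalgebra `K ⊗ H` with
unit `1 ⊗ 1` and product
`(k ⊗ h)(k' ⊗ h') = R⁻¹(π(h₍₁₎), k'₍₁₎) k k'₍₂₎ ⊗ h₍₂₎ h' R(π(h₍₃₎), k'₍₃₎)`. -/
def bowtie (π : H →ₐc[k] K) (R : Coquasitriangular k K) (S : K ⊗[k] H →ₗ[k] K ⊗[k] H) :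
    HopfData k (K ⊗[k] H) where
  mul := crossedMul (LinearMap.mul' k K) (LinearMap.mul' k H) (bowtieExchange π R)
  one := 1 ⊗ₜ 1
  comul := Coalgebra.comul
  counit := Coalgebra.counit
  antipode := S

end Transmutation

end

/-! Everything is read off from one Hopf algebra, B = K ⋈_R H. It contains K and H through Hopf
algebra maps i and j that satisfy the exchange relation j(h)i(x) = R⁻¹(π(h₁), x₁) i(x₂)j(h₂)
R(π(h₃), x₃) (`ExchangeRel`). Put ι(h) = iπ(S(h₁)) j(h₂) (`incl`). Then x # h ↦ i(x)ι(h) is inverse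
to the map of the theorem, because π and π∘S are convolution inverse to each other (`shear_shear`).
So the bosonization should be B in other coordinates, and the task is to compute with ι inside B.

That B is a Hopf algebra comes from a faithful representation. The operators x ↦ R⁻¹(π(h), x₁)x₂ and
x ↦ x₁R(π(h), x₂) are two commuting actions of H on K. Together with H itself they give an algebra
map H → End(K) ⊗ H (`twistedAct`), and this map and the left multiplications of K obey the exchange
relation (`fst_twistedAct_mul_snd`). Evaluation at 1 ∈ K shows that no information is lost
(`bowtieAct_injective`), so associativity, units and antipode are checked on operators. The
coproduct is multiplicative because the exchange map, being the flip conjugated by R, is a coalgebra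
map (`exchangeHom`).

In any Hopf algebra with the exchange relation, quasi-commutativity of R turns that relation into
the smash product relation ι(a)i(x) = i(x₁)ι(a⁽¹⁾)R(a⁽²⁾, x₂) (`ExchangeRel.incl_mul`). From it
follow ι(x ·_R y) = ι(x)ι(y) (`ExchangeRel.incl_transmutation_mul`) and, with the Drinfeld
functional u(x) = R(πS²(x₁), π(x₂)), ι(S_R(x)) = j(S(x₁)) iπ(x₂)
(`ExchangeRel.incl_transmutation_antipode`). The coproduct is Δι(a) = ι(a₁⁽¹⁾) ⊗ i(a₁⁽²⁾)ι(a₂)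
(`comul_incl`). Thus all structure maps of K # H_R match those of B, and the axioms are transported
(`isHopf_of_equiv`).

The braided axioms of H_R also come from B. Let P and p be the projections of B to H and K with
P(i(x)ι(a)) = ε(x)a and p(i(x)ι(a)) = ε(a)x. Then ι is injective, the adjoint coaction is (P ⊗ p)Δι
and the coproduct of H is (P ⊗ P)Δι, so compatibility with the product reduces to multiplicativity
of Δ in B.

Most computations take place in convolution rings, where Sweedler sums become products and the
cancellations are those of mutually inverse elements. The ground ring is an arbitrary commutative
ring until the final statement. -/

noncomputable section

set_option linter.unusedSectionVars false
open Coalgebra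

/-! ### Convolution rings of linear maps from a coalgebra to an algebra -/

namespace WithConv

variable {k C D X Y A A' : Type*} [CommRing k]
  [AddCommGroup C] [Module k C] [Coalgebra k C] [AddCommGroup D] [Module k D] [Coalgebra k D]
  [AddCommGroup X] [Module k X] [Coalgebra k X] [AddCommGroup Y] [Module k Y] [Coalgebra k Y]
  [Ring A] [Algebra k A] [Ring A'] [Algebra k A']

/-- Postcomposition with an algebra map, as a map of convolution rings. -/
def push (f : A →ₐ[k] A') : WithConv (C →ₗ[k] A) →+* WithConv (C →ₗ[k] A') where
  toFun x := toConv (f.toLinearMap ∘ₗ x.ofConv)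
  map_one' := by ext c; simp
  map_mul' x y := congrArg toConv (LinearMap.algHom_comp_convMul_distrib f x y)
  map_zero' := by ext c; simp
  map_add' x y := by ext c; simp

/-- Precomposition with a coalgebra map, as a map of convolution rings. -/
def pull (f : D →ₗc[k] C) : WithConv (C →ₗ[k] A) →+* WithConv (D →ₗ[k] A) where
  toFun x := toConv (x.ofConv ∘ₗ f.toLinearMap)
  map_one' := by ext c; simp
  map_mul' x y := congrArg toConv (LinearMap.convMul_comp_coalgHom_distrib x y f)
  map_zero' := by ext c; simp
  map_add' x y := by ext c; simp

@[simp] theorem push_apply (f : A →ₐ[k] A') (x : WithConv (C →ₗ[k] A)) (c : C) :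
    push f x c = f (x c) := rfl

@[simp] theorem pull_apply (f : D →ₗc[k] C) (x : WithConv (C →ₗ[k] A)) (d : D) :
    pull f x d = x (f d) := rfl

variable (A) in
/-- A linear form regarded as a linear map with values in the scalars of an algebra. -/
def scalar : WithConv (C →ₗ[k] k) →+* WithConv (C →ₗ[k] A) := push (Algebra.ofId k A)

@[simp] theorem scalar_apply (x : WithConv (C →ₗ[k] k)) (c : C) :
    scalar A x c = algebraMap k A (x c) := rfl

theorem push_scalar (f : A →ₐ[k] A') (x : WithConv (C →ₗ[k] k)) :
    push f (scalar A x) = scalar A' x := by ext c; simp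

theorem ext_apply {x y : WithConv (C →ₗ[k] A)} (h : ∀ c, x c = y c) : x = y :=
  WithConv.ext (LinearMap.ext h)

theorem scalar_mul_apply (s : WithConv (C →ₗ[k] k)) (x : WithConv (C →ₗ[k] A)) {ι : Type*}
    {c : C} (r : Repr k c ι) :
    (scalar A s * x) c = ∑ i ∈ r.index, s (r.left i) • x (r.right i) := by
  simp [r.convMul_apply, Algebra.smul_def]

theorem mul_scalar_apply (s : WithConv (C →ₗ[k] k)) (x : WithConv (C →ₗ[k] A)) {ι : Type*}
    {c : C} (r : Repr k c ι) :
    (x * scalar A s) c = ∑ i ∈ r.index, s (r.right i) • x (r.left i) := by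
  simp only [r.convMul_apply, Algebra.smul_def, scalar_apply]
  exact Finset.sum_congr rfl fun i _ => (Algebra.commutes _ _).symm

/-- A merely linear f does not respect convolution products, but it does commute with scalar
factors. This and its mirror image carry linear maps through the R-factors of the exchange map. -/
theorem comp_scalar_mul (f : A →ₗ[k] A') (s : WithConv (C →ₗ[k] k)) (x : WithConv (C →ₗ[k] A)) :
    toConv (f ∘ₗ (scalar A s * x).ofConv) = scalar A' s * toConv (f ∘ₗ x.ofConv) := by
  refine ext_apply fun c => ?_
  rw [scalar_mul_apply _ _ (ℛ k c)]
  refine (congrArg f (scalar_mul_apply s x (ℛ k c))).trans ?_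
  simp

theorem comp_mul_scalar (f : A →ₗ[k] A') (s : WithConv (C →ₗ[k] k)) (x : WithConv (C →ₗ[k] A)) :
    toConv (f ∘ₗ (x * scalar A s).ofConv) = toConv (f ∘ₗ x.ofConv) * scalar A' s := by
  refine ext_apply fun c => ?_
  rw [mul_scalar_apply _ _ (ℛ k c)]
  refine (congrArg f (mul_scalar_apply s x (ℛ k c))).trans ?_
  simp

/-! ### Triple products -/

/-- `a ⊗ b ⊗ c ↦ x(a) y(b) z(c)` -/
def triple (x y z : WithConv (C →ₗ[k] A)) : C ⊗[k] (C ⊗[k] C) →ₗ[k] A :=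
  LinearMap.mul' k A ∘ₗ TensorProduct.map x.ofConv
    (LinearMap.mul' k A ∘ₗ TensorProduct.map y.ofConv z.ofConv)

@[simp] theorem triple_tmul (x y z : WithConv (C →ₗ[k] A)) (a b c : C) :
    triple x y z (a ⊗ₜ (b ⊗ₜ c)) = x a * (y b * z c) := by
  simp [triple]

/-- Exhibits a threefold product as a linear map applied to the iterated coproduct, so that
identities can be checked on pure tensors a ⊗ b ⊗ c. -/
theorem mul_mul_apply (x y z : WithConv (C →ₗ[k] A)) (c : C) :
    (x * y * z) c = triple x y z (comul₃ k C c) := by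
  rw [mul_assoc, (ℛ k c).convMul_apply]
  simp only [triple, comul₃, LinearMap.comp_apply, ← (ℛ k c).eq, map_sum, LinearMap.lTensor_tmul,
    TensorProduct.map_tmul, LinearMap.mul'_apply]
  rfl

theorem comul₃_eq_sum {ι : Type*} {c : C} (r : Repr k c ι) :
    comul₃ k C c = ∑ i ∈ r.index, r.left i ⊗ₜ comul (r.right i) := by
  simp [comul₃, ← r.eq]

/-! ### The two legs of a tensor product -/

variable (k X Y) in
/-- `x ⊗ y ↦ x ε(y)` -/
def fstHom : X ⊗[k] Y →ₗc[k] X :=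
  (Coalgebra.TensorProduct.rid k k X).toCoalgHom.comp
    (Coalgebra.TensorProduct.map (CoalgHom.id k X) (counitCoalgHom k Y))

variable (k X Y) in
/-- `x ⊗ y ↦ ε(x) y` -/
def sndHom : X ⊗[k] Y →ₗc[k] Y :=
  (Coalgebra.TensorProduct.lid k Y).toCoalgHom.comp
    (Coalgebra.TensorProduct.map (counitCoalgHom k X) (CoalgHom.id k Y))

/-- A linear map on the first leg. -/
def fst : WithConv (X →ₗ[k] A) →+* WithConv (X ⊗[k] Y →ₗ[k] A) := pull (fstHom k X Y)

/-- A linear map on the second leg. -/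
def snd : WithConv (Y →ₗ[k] A) →+* WithConv (X ⊗[k] Y →ₗ[k] A) := pull (sndHom k X Y)

theorem fst_tmul (f : WithConv (X →ₗ[k] A)) (x : X) (y : Y) :
    fst f (x ⊗ₜ[k] y) = counit (R := k) y • f x :=
  map_smul f.ofConv _ _

theorem snd_tmul (f : WithConv (Y →ₗ[k] A)) (x : X) (y : Y) :
    snd f (x ⊗ₜ[k] y) = counit (R := k) x • f y :=
  map_smul f.ofConv _ _

theorem sum_counit_smul_map {V : Type*} [AddCommGroup V] [Module k V] {ι : Type*} {c : C}
    (r : Repr k c ι) (f : C →ₗ[k] V) :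
    ∑ i ∈ r.index, counit (R := k) (r.left i) • f (r.right i) = f c := by
  simp only [← map_smul, ← map_sum, sum_counit_smul]

theorem sum_map_counit_smul {V : Type*} [AddCommGroup V] [Module k V] {ι : Type*} {c : C}
    (r : Repr k c ι) (f : C →ₗ[k] V) :
    ∑ i ∈ r.index, counit (R := k) (r.right i) • f (r.left i) = f c := by
  have h := congrArg (TensorProduct.rid k C) (sum_tmul_counit_eq r)
  simp only [map_sum, TensorProduct.rid_tmul, one_smul] at h
  simp only [← map_smul, ← map_sum, h]

theorem mul_tmul_apply (F G : WithConv (X ⊗[k] Y →ₗ[k] A)) {ι κ : Type*} {x : X} {y : Y}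
    (r : Repr k x ι) (s : Repr k y κ) :
    (F * G) (x ⊗ₜ y) = ∑ i ∈ r.index, ∑ j ∈ s.index,
      F (r.left i ⊗ₜ s.left j) * G (r.right i ⊗ₜ s.right j) := by
  have h : (comul (x ⊗ₜ[k] y) : (X ⊗[k] Y) ⊗[k] (X ⊗[k] Y)) = ∑ i ∈ r.index, ∑ j ∈ s.index,
      (r.left i ⊗ₜ s.left j) ⊗ₜ (r.right i ⊗ₜ s.right j) := by
    rw [TensorProduct.comul_tmul, ← r.eq, ← s.eq]
    simp [TensorProduct.sum_tmul, TensorProduct.tmul_sum]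
    rw [Finset.sum_comm]
  rw [LinearMap.convMul_apply, h]
  simp

theorem fst_mul_apply (f : WithConv (X →ₗ[k] A)) (G : WithConv (X ⊗[k] Y →ₗ[k] A)) {ι : Type*}
    {x : X} (r : Repr k x ι) (y : Y) :
    (fst f * G : WithConv (X ⊗[k] Y →ₗ[k] A)) (x ⊗ₜ y) = ∑ i ∈ r.index, f (r.left i) * G (r.right i ⊗ₜ y) := by
  rw [mul_tmul_apply _ _ r (ℛ k y)]
  refine Finset.sum_congr rfl fun i _ => ?_
  simp only [fst_tmul, smul_mul_assoc]
  exact sum_counit_smul_map (ℛ k y)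
    (LinearMap.mulLeft k (f (r.left i)) ∘ₗ G.ofConv ∘ₗ TensorProduct.mk k X Y (r.right i))

theorem mul_fst_apply (f : WithConv (X →ₗ[k] A)) (G : WithConv (X ⊗[k] Y →ₗ[k] A)) {ι : Type*}
    {x : X} (r : Repr k x ι) (y : Y) :
    (G * fst f : WithConv (X ⊗[k] Y →ₗ[k] A)) (x ⊗ₜ y) = ∑ i ∈ r.index, G (r.left i ⊗ₜ y) * f (r.right i) := by
  rw [mul_tmul_apply _ _ r (ℛ k y)]
  refine Finset.sum_congr rfl fun i _ => ?_
  simp only [fst_tmul, mul_smul_comm]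
  exact sum_map_counit_smul (ℛ k y)
    (LinearMap.mulRight k (f (r.right i)) ∘ₗ G.ofConv ∘ₗ TensorProduct.mk k X Y (r.left i))

theorem snd_mul_apply (f : WithConv (Y →ₗ[k] A)) (G : WithConv (X ⊗[k] Y →ₗ[k] A)) {ι : Type*}
    (x : X) {y : Y} (r : Repr k y ι) :
    (snd f * G : WithConv (X ⊗[k] Y →ₗ[k] A)) (x ⊗ₜ y) = ∑ i ∈ r.index, f (r.left i) * G (x ⊗ₜ r.right i) := by
  rw [mul_tmul_apply _ _ (ℛ k x) r, Finset.sum_comm]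
  refine Finset.sum_congr rfl fun i _ => ?_
  simp only [snd_tmul, smul_mul_assoc]
  exact sum_counit_smul_map (ℛ k x)
    (LinearMap.mulLeft k (f (r.left i)) ∘ₗ G.ofConv ∘ₗ (TensorProduct.mk k X Y).flip (r.right i))

theorem fst_mul_snd_apply (f : WithConv (X →ₗ[k] A)) (g : WithConv (Y →ₗ[k] A)) (x : X) (y : Y) :
    (fst f * snd g : WithConv (X ⊗[k] Y →ₗ[k] A)) (x ⊗ₜ y) = f x * g y := by
  rw [fst_mul_apply _ _ (ℛ k x)]
  simp only [snd_tmul, mul_smul_comm]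
  exact sum_map_counit_smul (ℛ k x) (LinearMap.mulRight k (g y) ∘ₗ f.ofConv)

theorem snd_mul_fst_apply (f : WithConv (X →ₗ[k] A)) (g : WithConv (Y →ₗ[k] A)) (x : X) (y : Y) :
    (snd g * fst f : WithConv (X ⊗[k] Y →ₗ[k] A)) (x ⊗ₜ y) = g y * f x := by
  rw [mul_fst_apply _ _ (ℛ k x)]
  simp only [snd_tmul, smul_mul_assoc]
  exact sum_counit_smul_map (ℛ k x) (LinearMap.mulLeft k (g y) ∘ₗ f.ofConv)

theorem fst_snd_commute {f : WithConv (X →ₗ[k] A)} {g : WithConv (Y →ₗ[k] A)}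
    (h : ∀ x y, f x * g y = g y * f x) :
    (fst f * snd g : WithConv (X ⊗[k] Y →ₗ[k] A)) = snd g * fst f := by
  refine WithConv.ext (TensorProduct.ext' fun x y => ?_)
  exact (fst_mul_snd_apply f g x y).trans ((h x y).trans (snd_mul_fst_apply f g x y).symm)

theorem ext_tmul {F G : WithConv (X ⊗[k] Y →ₗ[k] A)} (h : ∀ x y, F (x ⊗ₜ y) = G (x ⊗ₜ y)) :
    F = G :=
  WithConv.ext (TensorProduct.ext' h)

end WithConv

open WithConv

/-! ### Algebra maps on a Hopf algebra and their convolution inverses -/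

namespace WithConv

variable {k H A A' : Type*} [CommRing k] [Ring H] [HopfAlgebra k H] [Ring A] [Algebra k A]
  [Ring A'] [Algebra k A']

/-- An algebra map, as an element of the convolution ring. -/
def hom (f : H →ₐ[k] A) : WithConv (H →ₗ[k] A) := toConv f.toLinearMap

/-- The convolution inverse of an algebra map. -/
def homInv (f : H →ₐ[k] A) : WithConv (H →ₗ[k] A) :=
  toConv (f.toLinearMap ∘ₗ HopfAlgebra.antipode k)

@[simp] theorem hom_apply (f : H →ₐ[k] A) (x : H) : hom f x = f x := rfl

@[simp] theorem homInv_apply (f : H →ₐ[k] A) (x : H) :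
    homInv f x = f (HopfAlgebra.antipode k x) := rfl

@[simp] theorem hom_mul_homInv (f : H →ₐ[k] A) : hom f * homInv f = 1 :=
  ((push f).map_mul (toConv LinearMap.id) (toConv (HopfAlgebra.antipode k))).symm.trans
    ((congrArg (push f) LinearMap.id_mul_antipode).trans (map_one _))

@[simp] theorem homInv_mul_hom (f : H →ₐ[k] A) : homInv f * hom f = 1 :=
  ((push f).map_mul (toConv (HopfAlgebra.antipode k)) (toConv LinearMap.id)).symm.trans
    ((congrArg (push f) LinearMap.antipode_mul_id).trans (map_one _))

@[simp] theorem push_hom (g : A →ₐ[k] A') (f : H →ₐ[k] A) : push g (hom f) = hom (g.comp f) := rfl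

@[simp] theorem push_homInv (g : A →ₐ[k] A') (f : H →ₐ[k] A) :
    push g (homInv f) = homInv (g.comp f) := rfl

/-- An algebra map `H → H ⊗ H → A` is the convolution product of its restrictions. -/
theorem hom_comp_comul (f g : H →ₐ[k] A) (h : H ⊗[k] H →ₐ[k] A)
    (hh : ∀ x y, h (x ⊗ₜ y) = f x * g y) :
    hom (h.comp (Bialgebra.comulAlgHom k H)) = hom f * hom g := by
  refine ext_apply fun x => ?_
  rw [(ℛ k x).convMul_apply]
  exact (congrArg h (ℛ k x).eq.symm).trans (by simp [hh])

/-- The inverse of a product is the product of the inverses in reverse order; this is the source of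
every order reversal caused by the antipode. -/
theorem homInv_comp_comul (f g : H →ₐ[k] A) (h : H ⊗[k] H →ₐ[k] A)
    (hh : ∀ x y, h (x ⊗ₜ y) = f x * g y) :
    homInv (h.comp (Bialgebra.comulAlgHom k H)) = homInv g * homInv f := by
  refine left_inv_eq_right_inv (homInv_mul_hom _) ?_
  rw [hom_comp_comul f g h hh, mul_assoc, ← mul_assoc (hom g)]
  simp

end WithConv

namespace Coalgebra.Repr

variable {k H : Type*} [CommRing k] [Ring H] [HopfAlgebra k H]

/-- `Δ(S(x)) = S(x₍₂₎) ⊗ S(x₍₁₎)` -/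
@[simps]
def antipode {ι : Type*} {x : H} (r : Repr k x ι) : Repr k (HopfAlgebra.antipode k x) ι where
  index := r.index
  left i := HopfAlgebra.antipode k (r.right i)
  right i := HopfAlgebra.antipode k (r.left i)
  eq := by
    -- With the identity of H ⊗ H as the algebra map, the inverse of Δ is Δ∘S, and the reversed
    -- product is (1 ⊗ S(x₁))(S(x₂) ⊗ 1).
    have h := homInv_comp_comul (Algebra.TensorProduct.includeLeft (R := k) (S := k) (A := H)
      (B := H)) (Algebra.TensorProduct.includeRight) (AlgHom.id k _) (by simp)
    have h' := congrArg (fun F : WithConv (H →ₗ[k] H ⊗[k] H) => F x) h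
    simp only [r.convMul_apply] at h'
    simpa using h'.symm

end Coalgebra.Repr

/-! ### Coquasitriangular forms: units, inverse and antipode -/

namespace Coquasitriangular

variable {k K : Type*} [CommRing k] [Ring K] [HopfAlgebra k K] (R : Coquasitriangular k K)

open HopfAlgebra

theorem form_mul_left {ι : Type*} (x y : K) {z : K} (r : Repr k z ι) :
    R.form ((x * y) ⊗ₜ z) =
      ∑ i ∈ r.index, R.form (x ⊗ₜ r.left i) * R.form (y ⊗ₜ r.right i) := by
  rw [R.mul_left, ← r.eq]
  simp

theorem form_mul_right {ι : Type*} {x : K} (r : Repr k x ι) (y z : K) :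
    R.form (x ⊗ₜ (y * z)) =
      ∑ i ∈ r.index, R.form (r.left i ⊗ₜ z) * R.form (r.right i ⊗ₜ y) := by
  rw [R.mul_right, ← r.eq]
  simp

theorem sum_form_mul_inv {ι κ : Type*} {x y : K} (r : Repr k x ι) (s : Repr k y κ) :
    ∑ i ∈ r.index, ∑ j ∈ s.index, R.form (r.left i ⊗ₜ s.left j) * R.inv (r.right i ⊗ₜ s.right j) =
      counit (R := k) x * counit (R := k) y := by
  have h := congrArg (fun F : WithConv (K ⊗[k] K →ₗ[k] k) => F (x ⊗ₜ y)) R.form_mul_inv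
  simp only [mul_tmul_apply _ _ r s] at h
  refine h.trans ?_
  simp [mul_comm]

/-- `Δ(1) = 1 ⊗ 1` -/
@[simps]
def _root_.Coalgebra.Repr.one (k A : Type*) [CommRing k] [Ring A] [Bialgebra k A] :
    Repr k (1 : A) Unit where
  index := Finset.univ
  left _ := 1
  right _ := 1
  eq := by simp [Algebra.TensorProduct.one_def]

-- The functional u = R(1, –) is idempotent under convolution because 1·1 = 1, and it is invertible
-- because R is; an invertible idempotent is the unit.
@[simp] theorem form_one_left (z : K) : R.form (1 ⊗ₜ z) = counit (R := k) z := by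
  let u : WithConv (K →ₗ[k] k) := toConv (TensorProduct.curry R.form 1)
  let v : WithConv (K →ₗ[k] k) := toConv (TensorProduct.curry R.inv 1)
  have huv : u * v = 1 := ext_apply fun z => by
    have := R.sum_form_mul_inv (.one k K) (ℛ k z)
    rw [(ℛ k z).convMul_apply]
    simpa [u, v] using this
  have huu : u * u = u := ext_apply fun z => by
    have := R.form_mul_left 1 1 (ℛ k z)
    rw [(ℛ k z).convMul_apply]
    simpa [u] using this.symm
  have hu : u = 1 := by
    calc u = u * (u * v) := by rw [huv, mul_one]
      _ = u * v := by rw [← mul_assoc, huu]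
      _ = 1 := huv
  exact congrArg (fun F : WithConv (K →ₗ[k] k) => F z) hu

@[simp] theorem form_one_right (z : K) : R.form (z ⊗ₜ 1) = counit (R := k) z := by
  let u : WithConv (K →ₗ[k] k) := toConv ((TensorProduct.curry R.form).flip 1)
  let v : WithConv (K →ₗ[k] k) := toConv ((TensorProduct.curry R.inv).flip 1)
  have huv : u * v = 1 := ext_apply fun z => by
    have := R.sum_form_mul_inv (ℛ k z) (.one k K)
    rw [(ℛ k z).convMul_apply]
    simpa [u, v] using this
  have huu : u * u = u := ext_apply fun z => by
    have := R.form_mul_right (ℛ k z) 1 1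
    rw [(ℛ k z).convMul_apply]
    simpa [u] using this.symm
  have hu : u = 1 := by
    calc u = u * (u * v) := by rw [huv, mul_one]
      _ = u * v := by rw [← mul_assoc, huu]
      _ = 1 := huv
  exact congrArg (fun F : WithConv (K →ₗ[k] k) => F z) hu

/-- Multiplicativity in the first argument makes R(S(x), y) a left convolution inverse of R, and
inverses are unique. -/
theorem inv_eq_form_antipode : R.inv = R.form ∘ₗ (antipode k).rTensor K := by
  refine toConv_injective (left_inv_eq_right_inv (a := toConv R.form) ?_ R.form_mul_inv).symm
  refine ext_tmul fun x y => ?_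
  rw [mul_tmul_apply _ _ (ℛ k x) (ℛ k y)]
  simp only [LinearMap.comp_apply, LinearMap.rTensor_tmul, ← form_mul_left]
  rw [← map_sum, ← TensorProduct.sum_tmul, sum_antipode_mul_eq_smul]
  simp [← TensorProduct.smul_tmul', mul_comm]

theorem inv_apply (x y : K) : R.inv (x ⊗ₜ y) = R.form (antipode k x ⊗ₜ y) := by
  rw [inv_eq_form_antipode]; rfl

@[simp] theorem inv_one_left (z : K) : R.inv (1 ⊗ₜ z) = counit (R := k) z := by
  simp [inv_apply]

@[simp] theorem inv_one_right (z : K) : R.inv (z ⊗ₜ 1) = counit (R := k) z := by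
  simp [inv_apply]

theorem inv_mul_left {ι : Type*} (x y : K) {z : K} (r : Repr k z ι) :
    R.inv ((x * y) ⊗ₜ z) =
      ∑ i ∈ r.index, R.inv (y ⊗ₜ r.left i) * R.inv (x ⊗ₜ r.right i) := by
  simp only [inv_apply, antipode_mul_antidistrib, R.form_mul_left _ _ r]

theorem inv_mul_right {ι : Type*} {x : K} (r : Repr k x ι) (y z : K) :
    R.inv (x ⊗ₜ (y * z)) =
      ∑ i ∈ r.index, R.inv (r.left i ⊗ₜ y) * R.inv (r.right i ⊗ₜ z) := by
  simp only [inv_apply, R.form_mul_right r.antipode, Repr.antipode_index, Repr.antipode_left,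
    Repr.antipode_right]
  exact Finset.sum_congr rfl fun i _ => mul_comm _ _

/-- R⁻¹ preserves the order of products in its second argument, so R⁻¹(x, S(y)) is a right inverse
of R⁻¹, and hence R. -/
theorem inv_antipode_right (x y : K) : R.inv (x ⊗ₜ antipode k y) = R.form (x ⊗ₜ y) := by
  have h : toConv (R.inv ∘ₗ (antipode k).lTensor K) = toConv R.form := by
    refine (left_inv_eq_right_inv R.form_mul_inv ?_).symm
    refine ext_tmul fun x y => ?_
    rw [mul_tmul_apply _ _ (ℛ k x) (ℛ k y), Finset.sum_comm]
    simp only [LinearMap.comp_apply, LinearMap.lTensor_tmul, ← inv_mul_right]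
    rw [← map_sum, ← TensorProduct.tmul_sum, sum_mul_antipode_eq_smul]
    simp
  exact congrArg (fun F : WithConv (K ⊗[k] K →ₗ[k] k) => F (x ⊗ₜ y)) h

theorem form_antipode_antipode (x y : K) :
    R.form (antipode k x ⊗ₜ antipode k y) = R.form (x ⊗ₜ y) := by
  rw [← inv_apply, inv_antipode_right]

/-! ### The form pulled back along a Hopf algebra map, as an element of a convolution ring -/

variable {H A : Type*} [Ring H] [HopfAlgebra k H] [Ring A] [Algebra k A] (π : H →ₐc[k] K)

/-- `h ⊗ x ↦ R(π(h), x)` -/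
def form₁ : WithConv (H ⊗[k] K →ₗ[k] k) := toConv (R.form ∘ₗ (π : H →ₗ[k] K).rTensor K)

/-- `h ⊗ x ↦ R⁻¹(π(h), x)` -/
def inv₁ : WithConv (H ⊗[k] K →ₗ[k] k) := toConv (R.inv ∘ₗ (π : H →ₗ[k] K).rTensor K)

@[simp] theorem form₁_tmul (h : H) (x : K) : R.form₁ π (h ⊗ₜ x) = R.form (π h ⊗ₜ x) := rfl

@[simp] theorem inv₁_tmul (h : H) (x : K) : R.inv₁ π (h ⊗ₜ x) = R.inv (π h ⊗ₜ x) := rfl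

/-- `h ⊗ x ↦ π(h) ⊗ x` -/
def baseChange : H ⊗[k] K →ₗc[k] K ⊗[k] K :=
  Coalgebra.TensorProduct.map (π : H →ₗc[k] K) (CoalgHom.id k K)

theorem pull_form : pull (baseChange π) (toConv R.form) = R.form₁ π := rfl

theorem pull_inv : pull (baseChange π) (toConv R.inv) = R.inv₁ π := rfl

@[simp] theorem form₁_mul_inv₁ : R.form₁ π * R.inv₁ π = 1 := by
  rw [← pull_form, ← pull_inv, ← map_mul, R.form_mul_inv, map_one]

@[simp] theorem inv₁_mul_form₁ : R.inv₁ π * R.form₁ π = 1 := by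
  rw [← pull_form, ← pull_inv, ← map_mul, R.inv_mul_form, map_one]

/-- `x₍₁₎ π(h₍₁₎) R(π(h₍₂₎), x₍₂₎) = R(π(h₍₁₎), x₍₁₎) π(h₍₂₎) x₍₂₎` in an algebra over `K`. -/
theorem snd_fst_form₁ (i : K →ₐ[k] A) :
    snd (hom i) * fst (hom (i.comp (π : H →ₐ[k] K))) * scalar A (R.form₁ π) =
      scalar A (R.form₁ π) * fst (hom (i.comp (π : H →ₐ[k] K))) * snd (hom i) := by
  have h := congrArg (fun F => push i (pull (baseChange π) F)) R.comm
  have hr : push i (pull (baseChange π) (toConv (Algebra.linearMap k K ∘ₗ R.form))) =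
      scalar A (R.form₁ π) := ext_apply fun c => i.commutes _
  simp only [map_mul, hr] at h
  rw [mul_assoc (scalar A (R.form₁ π))]
  convert h using 2
  · refine ext_tmul fun x y => (snd_mul_fst_apply _ _ x y).trans ?_
    simp [baseChange]
  · refine ext_tmul fun x y => (fst_mul_snd_apply _ _ x y).trans ?_
    simp [baseChange]

/-- Quasi-commutativity multiplied by R⁻¹ on both sides. -/
theorem inv₁_snd_fst (i : K →ₐ[k] A) :
    scalar A (R.inv₁ π) * snd (hom i) * fst (hom (i.comp (π : H →ₐ[k] K))) =
      fst (hom (i.comp (π : H →ₐ[k] K))) * snd (hom i) * scalar A (R.inv₁ π) := by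
  have h := congrArg (fun F => scalar A (R.inv₁ π) * F * scalar A (R.inv₁ π))
    (R.snd_fst_form₁ π i)
  have h1 : scalar A (R.inv₁ π) * scalar A (R.form₁ π) = 1 := by
    rw [← map_mul, inv₁_mul_form₁, map_one]
  have h2 : scalar A (R.form₁ π) * scalar A (R.inv₁ π) = 1 := by
    rw [← map_mul, form₁_mul_inv₁, map_one]
  simp only [mul_assoc, h2, mul_one] at h
  rw [← mul_assoc (scalar A (R.inv₁ π)) (scalar A (R.form₁ π)), h1, one_mul] at h
  simpa only [mul_assoc] using h

end Coquasitriangular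

namespace WithConv

variable {k H A : Type*} [CommRing k] [Ring H] [HopfAlgebra k H] [Ring A] [Algebra k A]

/-- The convolution product of two algebra maps with commuting images. -/
def homMul (f g : H →ₐ[k] A) (h : ∀ x y, Commute (f x) (g y)) : H →ₐ[k] A :=
  (Algebra.TensorProduct.lift f g h).comp (Bialgebra.comulAlgHom k H)

theorem hom_homMul (f g : H →ₐ[k] A) (h : ∀ x y, Commute (f x) (g y)) :
    hom (homMul f g h) = hom f * hom g :=
  hom_comp_comul f g _ (by simp)

theorem commute_homMul {f g : H →ₐ[k] A} (h : ∀ x y, Commute (f x) (g y)) {a : A}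
    (hf : ∀ x, Commute (f x) a) (hg : ∀ x, Commute (g x) a) (x : H) :
    Commute (homMul f g h x) a := by
  have e : homMul f g h x = ∑ i ∈ (ℛ k x).index, f ((ℛ k x).left i) * g ((ℛ k x).right i) := by
    rw [← hom_apply, hom_homMul, (ℛ k x).convMul_apply]
    rfl
  rw [e]
  exact Commute.sum_left _ _ _ fun i _ => (hf _).mul_left (hg _)

end WithConv

/-! ### Crossed products: multiplicative maps and compatible coalgebra structures -/

section CrossedMul

variable {k V W : Type*} [CommRing k] [AddCommGroup V] [Module k V] [AddCommGroup W] [Module k W]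

/-- A linear map that turns `v ⊗ w` into a product `i(v) j(w)` is multiplicative for the crossed
product if it turns the exchange map into the product `j(w) i(v)`. -/
theorem map_crossedMul {A : Type*} [Ring A] [Algebra k A] {mV : V ⊗[k] V →ₗ[k] V}
    {mW : W ⊗[k] W →ₗ[k] W} {τ : W ⊗[k] V →ₗ[k] V ⊗[k] W} {i : V →ₗ[k] A} {j : W →ₗ[k] A}
    {μ : V ⊗[k] W →ₗ[k] A} (hμ : ∀ v w, μ (v ⊗ₜ w) = i v * j w)
    (hi : ∀ v v', i (mV (v ⊗ₜ v')) = i v * i v') (hj : ∀ w w', j (mW (w ⊗ₜ w')) = j w * j w')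
    (hτ : ∀ w v, μ (τ (w ⊗ₜ v)) = j w * i v) (x y : V ⊗[k] W) :
    μ (crossedMul mV mW τ (x ⊗ₜ y)) = μ x * μ y := by
  induction x using TensorProduct.induction_on with
  | zero => simp
  | add x x' hx hx' => simp only [TensorProduct.add_tmul, map_add, hx, hx', add_mul]
  | tmul v w =>
    induction y using TensorProduct.induction_on with
    | zero => simp
    | add y y' hy hy' => simp only [TensorProduct.tmul_add, map_add, hy, hy', mul_add]
    | tmul v' w' =>
      rw [crossedMul_tmul, hμ, hμ]
      have key : ∀ t : V ⊗[k] W, μ (TensorProduct.map (mV ∘ₗ TensorProduct.mk k V V v)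
          (mW ∘ₗ (TensorProduct.mk k W W).flip w') t) = i v * μ t * j w' := by
        intro t
        induction t using TensorProduct.induction_on with
        | zero => simp
        | add s t hs ht => simp only [map_add, hs, ht, mul_add, add_mul]
        | tmul a b => simp [hμ, hi, hj, mul_assoc]
      rw [key, hτ]
      simp only [mul_assoc]

/-- A map on `V ⊗ V` gives the componentwise product on `(V ⊗ V) ⊗ (V ⊗ V)`. -/
theorem crossedMul_comm_eq (m : V ⊗[k] V →ₗ[k] V) :
    crossedMul m m (TensorProduct.comm k V V).toLinearMap =
      TensorProduct.map m m ∘ₗ (TensorProduct.tensorTensorTensorComm k V V V V).toLinearMap := by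
  refine TensorProduct.ext_fourfold' fun a b c d => ?_
  rw [crossedMul_tmul]
  simp

variable [Coalgebra k V] [Coalgebra k W]

/-- The crossed product of coalgebra maps, as a coalgebra map. -/
def crossedMulHom (mV : V ⊗[k] V →ₗc[k] V) (mW : W ⊗[k] W →ₗc[k] W)
    (τ : W ⊗[k] V →ₗc[k] V ⊗[k] W) : (V ⊗[k] W) ⊗[k] (V ⊗[k] W) →ₗc[k] V ⊗[k] W :=
  (Coalgebra.TensorProduct.map mV mW).comp <|
    (Coalgebra.TensorProduct.assoc k k V V (W ⊗[k] W)).symm.toCoalgHom.comp <|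
    (CoalgHom.lTensor V ((Coalgebra.TensorProduct.assoc k k V W W).toCoalgHom.comp <|
      (CoalgHom.rTensor W τ).comp
        (Coalgebra.TensorProduct.assoc k k W V W).symm.toCoalgHom)).comp <|
    (Coalgebra.TensorProduct.assoc k k V W (V ⊗[k] W)).toCoalgHom

/-- If both products and the exchange map are coalgebra maps, so is the crossed product, being a
composite of such maps. For the tensor product coalgebra this says exactly that the coproduct is
multiplicative. -/
theorem comul_crossedMul (mV : V ⊗[k] V →ₗc[k] V) (mW : W ⊗[k] W →ₗc[k] W)
    (τ : W ⊗[k] V →ₗc[k] V ⊗[k] W) (x y : V ⊗[k] W) :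
    comul (R := k) (crossedMulHom mV mW τ (x ⊗ₜ y)) =
      crossedMul (crossedMulHom mV mW τ : _ →ₗ[k] V ⊗[k] W)
        (crossedMulHom mV mW τ : _ →ₗ[k] V ⊗[k] W)
        (TensorProduct.comm k (V ⊗[k] W) (V ⊗[k] W)).toLinearMap
        (comul (R := k) x ⊗ₜ comul (R := k) y) := by
  rw [← CoalgHomClass.map_comp_comul_apply, crossedMul_comm_eq]
  rfl

theorem counit_crossedMul (mV : V ⊗[k] V →ₗc[k] V) (mW : W ⊗[k] W →ₗc[k] W)
    (τ : W ⊗[k] V →ₗc[k] V ⊗[k] W) (x y : V ⊗[k] W) :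
    counit (R := k) (crossedMulHom mV mW τ (x ⊗ₜ y)) =
      counit (R := k) x * counit (R := k) y := by
  rw [CoalgHomClass.counit_comp_apply, TensorProduct.counit_tmul, smul_eq_mul, mul_comm]

end CrossedMul

/-! ### The faithful representation of K ⋈_R H -/

namespace Coquasitriangular

variable {k K H : Type*} [CommRing k] [Ring K] [HopfAlgebra k K] [Ring H] [HopfAlgebra k H]
  (R : Coquasitriangular k K) (π : H →ₐc[k] K)

/-- `(h, x) ↦ R⁻¹(π(h), x₍₁₎) x₍₂₎` -/
def leftAct : H →ₐ[k] Module.End k K :=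
  AlgHom.ofLinearMap
    { toFun := fun h => (scalar K (toConv (TensorProduct.curry R.inv (π h))) *
        toConv LinearMap.id).ofConv
      map_add' := fun x y => by simp only [map_add, toConv_add, add_mul, ofConv_add]
      map_smul' := fun c x => by
        ext y
        rw [scalar_mul_apply _ _ (ℛ k y)]
        change _ = c • (scalar K (toConv (TensorProduct.curry R.inv (π x))) *
          toConv LinearMap.id : WithConv (K →ₗ[k] K)) y
        rw [scalar_mul_apply _ _ (ℛ k y)]
        simp [Finset.smul_sum, mul_smul] }
    (by
      ext y
      refine (scalar_mul_apply _ _ (ℛ k y)).trans ?_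
      simp [sum_counit_smul])
    (fun x y => by
      -- Two reversals agree: R⁻¹ reverses products in its first argument, and in a composite of two
      -- such operators the inner one consumes the first tensor factor of the coproduct.
      have h : toConv (TensorProduct.curry R.inv (π (x * y))) =
          toConv (TensorProduct.curry R.inv (π y)) * toConv (TensorProduct.curry R.inv (π x)) :=
        ext_apply fun z => by
          rw [(ℛ k z).convMul_apply]
          simp [R.inv_mul_left _ _ (ℛ k z)]
      have h' := comp_scalar_mul (scalar K (toConv (TensorProduct.curry R.inv (π x))) *
        toConv LinearMap.id).ofConv (toConv (TensorProduct.curry R.inv (π y)))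
        (toConv LinearMap.id)
      refine (congrArg ofConv (h'.trans (Eq.trans ?_
        (congrArg (fun s => scalar K s * toConv LinearMap.id) h).symm))).symm
      simp only [map_mul, mul_assoc]
      rfl)

/-- `(h, x) ↦ x₍₁₎ R(π(h), x₍₂₎)` -/
def rightAct : H →ₐ[k] Module.End k K :=
  AlgHom.ofLinearMap
    { toFun := fun h => (toConv LinearMap.id *
        scalar K (toConv (TensorProduct.curry R.form (π h)))).ofConv
      map_add' := fun x y => by simp only [map_add, toConv_add, mul_add, ofConv_add]
      map_smul' := fun c x => by
        ext y
        rw [mul_scalar_apply _ _ (ℛ k y)]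
        change _ = c • (toConv LinearMap.id *
          scalar K (toConv (TensorProduct.curry R.form (π x))) : WithConv (K →ₗ[k] K)) y
        rw [mul_scalar_apply _ _ (ℛ k y)]
        simp [Finset.smul_sum, mul_smul] }
    (by
      ext y
      refine (mul_scalar_apply _ _ (ℛ k y)).trans ?_
      simpa using sum_map_counit_smul (ℛ k y) LinearMap.id)
    (fun x y => by
      have h : toConv (TensorProduct.curry R.form (π (x * y))) =
          toConv (TensorProduct.curry R.form (π x)) * toConv (TensorProduct.curry R.form (π y)) :=
        ext_apply fun z => by
          rw [(ℛ k z).convMul_apply]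
          simp [R.form_mul_left _ _ (ℛ k z)]
      have h' := comp_mul_scalar (toConv LinearMap.id *
        scalar K (toConv (TensorProduct.curry R.form (π x)))).ofConv
        (toConv (TensorProduct.curry R.form (π y))) (toConv LinearMap.id)
      refine (congrArg ofConv (h'.trans (Eq.trans ?_
        (congrArg (fun s => toConv LinearMap.id * scalar K s) h).symm))).symm
      simp only [map_mul, ← mul_assoc]
      rfl)

theorem leftAct_apply (h : H) {ι : Type*} {x : K} (r : Repr k x ι) :
    R.leftAct π h x = ∑ i ∈ r.index, R.inv (π h ⊗ₜ r.left i) • r.right i :=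
  scalar_mul_apply _ _ r

theorem rightAct_apply (h : H) {ι : Type*} {x : K} (r : Repr k x ι) :
    R.rightAct π h x = ∑ i ∈ r.index, R.form (π h ⊗ₜ r.right i) • r.left i :=
  mul_scalar_apply _ _ r

/-- The two actions use opposite ends of the coproduct of K, so this is coassociativity in the form
of associativity of convolution. -/
theorem leftAct_rightAct_commute (x y : H) : Commute (R.leftAct π x) (R.rightAct π y) := by
  have h₁ := comp_mul_scalar (R.leftAct π x) (toConv (TensorProduct.curry R.form (π y)))
    (toConv LinearMap.id)
  have h₂ := comp_scalar_mul (R.rightAct π y) (toConv (TensorProduct.curry R.inv (π x)))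
    (toConv LinearMap.id)
  refine congrArg ofConv (h₁.trans (Eq.trans ?_ h₂.symm))
  exact mul_assoc (scalar K (toConv (TensorProduct.curry R.inv (π x)))) (toConv LinearMap.id)
    (scalar K (toConv (TensorProduct.curry R.form (π y))))

/-- The left half of the exchange relation, for operators. It expresses R⁻¹(h, xy) = R⁻¹(h₁,
x)R⁻¹(h₂, y). -/
theorem fst_leftAct_mul_snd :
    fst (hom (R.leftAct π)) * snd (hom (Algebra.lmul k K)) =
      scalar _ (R.inv₁ π) * (snd (hom (Algebra.lmul k K)) * fst (hom (R.leftAct π))) := by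
  refine ext_tmul fun h x => ?_
  rw [fst_mul_snd_apply, mul_tmul_apply _ _ (ℛ k h) (ℛ k x)]
  ext y
  simp only [snd_mul_fst_apply, hom_apply, scalar_apply, ← Algebra.smul_def, inv₁_tmul,
    LinearMap.sum_apply, LinearMap.smul_apply, Module.End.mul_apply, Algebra.coe_lmul_eq_mul, LinearMap.mul_apply',
    R.leftAct_apply π _ ((ℛ k x).mul (ℛ k y)), R.leftAct_apply π _ (ℛ k y)]
  simp only [Repr.mul_index, Repr.mul_left, Repr.mul_right, Finset.sum_product,
    R.inv_mul_right ((ℛ k h).induced π), Repr.induced_index, Repr.induced_left, Repr.induced_right,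
    Function.comp_apply, Finset.sum_smul, Finset.mul_sum, Finset.smul_sum]
  refine Eq.symm (Finset.sum_comm.trans (Finset.sum_congr rfl fun i _ => Finset.sum_comm.trans
    (Finset.sum_congr rfl fun j _ => Finset.sum_congr rfl fun l _ => ?_)))
  rw [mul_smul_comm, smul_smul]

/-- The right half of the exchange relation. Since R(h, xy) = R(h₁, y)R(h₂, x), the scalar that
involves x splits off at the other end. -/
theorem fst_rightAct_mul_snd :
    fst (hom (R.rightAct π)) * snd (hom (Algebra.lmul k K)) =
      snd (hom (Algebra.lmul k K)) * fst (hom (R.rightAct π)) * scalar _ (R.form₁ π) := by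
  refine ext_tmul fun h x => ?_
  rw [fst_mul_snd_apply, mul_tmul_apply _ _ (ℛ k h) (ℛ k x)]
  ext y
  simp only [snd_mul_fst_apply, hom_apply, scalar_apply, ← Algebra.smul_def, form₁_tmul,
    LinearMap.sum_apply, LinearMap.smul_apply, Module.End.mul_apply,
    Algebra.coe_lmul_eq_mul, LinearMap.mul_apply', ← Algebra.commutes,
    R.rightAct_apply π _ ((ℛ k x).mul (ℛ k y)), R.rightAct_apply π _ (ℛ k y)]
  simp only [Repr.mul_index, Repr.mul_left, Repr.mul_right, Finset.sum_product,
    R.form_mul_right ((ℛ k h).induced π), Repr.induced_index, Repr.induced_left, Repr.induced_right,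
    Function.comp_apply, Finset.sum_smul, Finset.mul_sum, Finset.smul_sum]
  refine Eq.symm (Finset.sum_comm.trans (Finset.sum_congr rfl fun i _ => Finset.sum_comm.trans
    (Finset.sum_congr rfl fun j _ => Finset.sum_congr rfl fun l _ => ?_)))
  rw [mul_smul_comm, smul_smul, mul_comm (R.form _)]

end Coquasitriangular

namespace Coquasitriangular

variable {k K H : Type*} [CommRing k] [Ring K] [HopfAlgebra k K] [Ring H] [HopfAlgebra k H]
  (R : Coquasitriangular k K) (π : H →ₐc[k] K)

/-- Operators on `K` with coefficients in `H`. -/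
def OpTensor (k K H : Type*) [CommRing k] [Ring K] [Algebra k K] [Ring H] [Algebra k H] :=
  Module.End k K ⊗[k] H

section OpTensor

variable (k K H : Type*) [CommRing k] [Ring K] [Algebra k K] [Ring H] [Algebra k H]

instance : Ring (OpTensor k K H) := inferInstanceAs (Ring (Module.End k K ⊗[k] H))

instance : Algebra k (OpTensor k K H) := inferInstanceAs (Algebra k (Module.End k K ⊗[k] H))

/-- Operators on `K`, as operators with coefficients in `H`. -/
def inclEnd : Module.End k K →ₐ[k] OpTensor k K H :=
  (Algebra.TensorProduct.includeLeft : Module.End k K →ₐ[k] Module.End k K ⊗[k] H)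

/-- Elements of `H`, as operators with coefficients in `H`. -/
def inclRight : H →ₐ[k] OpTensor k K H :=
  (Algebra.TensorProduct.includeRight : H →ₐ[k] Module.End k K ⊗[k] H)

/-- Left multiplications of `K`, as operators with coefficients in `H`. -/
def mulAct : K →ₐ[k] OpTensor k K H := (inclEnd k K H).comp (Algebra.lmul k K)

variable {k K H}

theorem commute_incl (f : Module.End k K) (x : H) :
    Commute (inclEnd k K H f) (inclRight k K H x) := by
  change (f ⊗ₜ[k] (1 : H)) * ((1 : Module.End k K) ⊗ₜ[k] x) =
    ((1 : Module.End k K) ⊗ₜ[k] x) * (f ⊗ₜ[k] (1 : H))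
  simp

/-- Evaluation of an operator at `1`. -/
def evalOne : OpTensor k K H →ₗ[k] K ⊗[k] H :=
  (LinearMap.rTensor H (LinearMap.applyₗ (1 : K)) : Module.End k K ⊗[k] H →ₗ[k] K ⊗[k] H)

theorem evalOne_mul (f g : Module.End k K) (x : H) :
    evalOne (inclEnd k K H f * (inclRight k K H x * inclEnd k K H g)) = f (g 1) ⊗ₜ x := by
  change LinearMap.rTensor H (LinearMap.applyₗ (1 : K)) ((f ⊗ₜ[k] (1 : H)) *
    (((1 : Module.End k K) ⊗ₜ[k] x) * (g ⊗ₜ[k] (1 : H)))) = _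
  simp

end OpTensor

/-- `h ↦ (R⁻¹(π(h₍₁₎), x₍₁₎) x₍₂₎ R(π(h₍₃₎), x₍₃₎)) ⊗ h₍₂₎`, with `x` the argument of an operator. -/
def twistedAct : H →ₐ[k] OpTensor k K H :=
  homMul (homMul ((inclEnd k K H).comp (R.leftAct π)) (inclRight k K H)
      (fun _ y => commute_incl _ y))
    ((inclEnd k K H).comp (R.rightAct π))
    (fun x y => commute_homMul _
      (fun z => (R.leftAct_rightAct_commute π z y).map (inclEnd k K H))
      (fun z => (commute_incl _ z).symm) x)

theorem hom_twistedAct : hom (R.twistedAct π) =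
    push (inclEnd k K H) (hom (R.leftAct π)) *
      hom (inclRight k K H) *
      push (inclEnd k K H) (hom (R.rightAct π)) :=
  (hom_homMul _ _ _).trans (congrArg (· * _) (hom_homMul _ _ _))

theorem fst_push {X Y A A' : Type*} [AddCommGroup X] [Module k X] [Coalgebra k X]
    [AddCommGroup Y] [Module k Y] [Coalgebra k Y] [Ring A] [Algebra k A] [Ring A'] [Algebra k A']
    (f : A →ₐ[k] A') (x : WithConv (X →ₗ[k] A)) :
    (fst (push f x) : WithConv (X ⊗[k] Y →ₗ[k] A')) = push f (fst x) := rfl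

theorem snd_push {X Y A A' : Type*} [AddCommGroup X] [Module k X] [Coalgebra k X]
    [AddCommGroup Y] [Module k Y] [Coalgebra k Y] [Ring A] [Algebra k A] [Ring A'] [Algebra k A']
    (f : A →ₐ[k] A') (x : WithConv (Y →ₗ[k] A)) :
    (snd (push f x) : WithConv (X ⊗[k] Y →ₗ[k] A')) = push f (snd x) := rfl

/-- The multiplication by x is moved to the left past the three factors of `twistedAct` in turn: the
right action produces R, the coefficients in H commute with it, and the left action produces R⁻¹. -/
theorem fst_twistedAct_mul_snd :
    fst (hom (R.twistedAct π)) * snd (hom (mulAct k K H)) =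
      scalar _ (R.inv₁ π) * (snd (hom (mulAct k K H)) * fst (hom (R.twistedAct π))) *
        scalar _ (R.form₁ π) := by
  have hL := congrArg (push (inclEnd k K H))
    (R.fst_leftAct_mul_snd π)
  have hR := congrArg (push (inclEnd k K H))
    (R.fst_rightAct_mul_snd π)
  simp only [map_mul, ← fst_push, ← snd_push, push_scalar] at hL hR
  have hC : fst (hom (inclRight k K H)) *
      snd (push (inclEnd k K H) (hom (Algebra.lmul k K))) =
      snd (push (inclEnd k K H) (hom (Algebra.lmul k K))) *
      fst (hom (inclRight k K H)) :=
    fst_snd_commute fun x y => (commute_incl (Algebra.lmul k K y) x).symm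
  have hM : hom (mulAct k K H) =
    push (inclEnd k K H) (hom (Algebra.lmul k K)) := rfl
  rw [hom_twistedAct, hM, map_mul, map_mul, mul_assoc _ _ (snd _), hR]
  simp only [← mul_assoc] at hL hR hC ⊢
  rw [mul_assoc (fst (push _ (hom (R.leftAct π)))) (fst _) (snd _), hC, ← mul_assoc, hL]

theorem leftAct_one (h : H) : R.leftAct π h 1 = counit (R := k) h • (1 : K) := by
  simp [R.leftAct_apply π h (.one k K)]

theorem rightAct_one (h : H) : R.rightAct π h 1 = counit (R := k) h • (1 : K) := by
  simp [R.rightAct_apply π h (.one k K)]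

/-- `x ⊗ h` acts on `K ⊗ H` as `x` after `h`. -/
def bowtieAct : K ⊗[k] H →ₗ[k] OpTensor k K H :=
  LinearMap.mul' k _ ∘ₗ
    TensorProduct.map (mulAct k K H).toLinearMap (R.twistedAct π).toLinearMap

theorem bowtieAct_tmul (x : K) (h : H) :
    R.bowtieAct π (x ⊗ₜ h) = mulAct k K H x * R.twistedAct π h := rfl

/-- Evaluation at 1 is a left inverse: both actions of h on 1 ∈ K are multiplication by ε(h), so
only x ⊗ h survives. -/
theorem bowtieAct_injective : Function.Injective (R.bowtieAct π) := by
  have h : evalOne ∘ₗ R.bowtieAct π = LinearMap.id := by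
    refine TensorProduct.ext' fun x h => ?_
    let L : OpTensor k K H →ₗ[k] K ⊗[k] H := evalOne ∘ₗ LinearMap.mulLeft k (mulAct k K H x)
    have h₁ : L ∘ₗ triple (push (inclEnd k K H) (hom (R.leftAct π)))
        (hom (inclRight k K H)) (push (inclEnd k K H) (hom (R.rightAct π))) =
        TensorProduct.mk k K H x ∘ₗ triple 1 (toConv LinearMap.id) 1 := by
      refine TensorProduct.ext_threefold' fun a b c => ?_
      have e := evalOne_mul (Algebra.lmul k K x * R.leftAct π a) (R.rightAct π c) b
      rw [map_mul (inclEnd k K H), mul_assoc] at e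
      simp only [LinearMap.comp_apply, triple_tmul]
      refine e.trans ?_
      simp only [rightAct_one, map_smul, Module.End.mul_apply, leftAct_one]
      simp [Algebra.algebraMap_eq_smul_one, TensorProduct.smul_tmul', smul_smul, mul_comm]
    calc evalOne (R.bowtieAct π (x ⊗ₜ h)) = L (hom (R.twistedAct π) h) := rfl
      _ = x ⊗ₜ ((1 * toConv LinearMap.id * 1 : WithConv (H →ₗ[k] H)) h) := by
        rw [hom_twistedAct, mul_mul_apply, mul_mul_apply]
        exact congrArg (fun F => F (comul₃ k H h)) h₁
      _ = x ⊗ₜ h := by rw [one_mul, mul_one]; rfl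
  exact Function.LeftInverse.injective (g := evalOne) (LinearMap.congr_fun h)

theorem bowtieExchange_eq : toConv (bowtieExchange π R) =
    scalar _ (R.inv₁ π) * toConv (TensorProduct.comm k H K).toLinearMap *
      scalar _ (R.form₁ π) := rfl

theorem bowtieAct_exchange (h : H) (x : K) :
    R.bowtieAct π (bowtieExchange π R (h ⊗ₜ x)) = R.twistedAct π h * mulAct k K H x := by
  have h₁ : toConv (R.bowtieAct π ∘ₗ bowtieExchange π R) =
      fst (hom (R.twistedAct π)) * snd (hom (mulAct k K H)) := by
    rw [fst_twistedAct_mul_snd]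
    have e : toConv (R.bowtieAct π ∘ₗ (TensorProduct.comm k H K).toLinearMap) =
        snd (hom (mulAct k K H)) * fst (hom (R.twistedAct π)) :=
      ext_tmul fun h x => (snd_mul_fst_apply _ _ h x).symm
    rw [← e]
    exact (comp_mul_scalar (R.bowtieAct π) (R.form₁ π) (scalar _ (R.inv₁ π) *
      toConv (TensorProduct.comm k H K).toLinearMap)).trans
      (congrArg (· * _) (comp_scalar_mul (R.bowtieAct π) _ _))
  exact (congrArg (fun F : WithConv (H ⊗[k] K →ₗ[k] _) => F (h ⊗ₜ x)) h₁).trans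
    (fst_mul_snd_apply _ _ h x)

/-- Together with injectivity, this makes K ⋈_R H inherit associativity from the algebra of
operators. -/
theorem bowtieAct_mul (x y : K ⊗[k] H) :
    R.bowtieAct π (crossedMul (LinearMap.mul' k K) (LinearMap.mul' k H) (bowtieExchange π R)
      (x ⊗ₜ y)) = R.bowtieAct π x * R.bowtieAct π y :=
  map_crossedMul (i := (mulAct k K H).toLinearMap) (j := (R.twistedAct π).toLinearMap)
    (R.bowtieAct_tmul π) (by simp) (by simp) (R.bowtieAct_exchange π) x y

/-- `c ↦ f(c₍₁₎) ⊗ g(c₍₂₎)` as a convolution product. -/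
theorem _root_.WithConv.incl_mul_incl {C A B : Type*} [AddCommGroup C] [Module k C]
    [Coalgebra k C] [Ring A] [Algebra k A] [Ring B] [Algebra k B]
    (f : WithConv (C →ₗ[k] A)) (g : WithConv (C →ₗ[k] B)) :
    push (Algebra.TensorProduct.includeLeft : A →ₐ[k] A ⊗[k] B) f *
      push (Algebra.TensorProduct.includeRight : B →ₐ[k] A ⊗[k] B) g =
      toConv (TensorProduct.map f.ofConv g.ofConv ∘ₗ comul) := by
  refine ext_apply fun c => ?_
  rw [(ℛ k c).convMul_apply]
  simp [← (ℛ k c).eq]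

/-- The exchange map of `K ⋈_R H` is a map of coalgebras. -/
def exchangeHom : H ⊗[k] K →ₗc[k] K ⊗[k] H where
  toLinearMap := bowtieExchange π R
  counit_comp := by
    have h : push (Bialgebra.counitAlgHom k (K ⊗[k] H)) (toConv (bowtieExchange π R)) = 1 := by
      have hc : push (Bialgebra.counitAlgHom k (K ⊗[k] H))
          (toConv (TensorProduct.comm k H K).toLinearMap) = 1 :=
        ext_tmul fun x y => by simp [mul_comm]
      rw [bowtieExchange_eq, map_mul, map_mul, push_scalar, push_scalar, hc, mul_one, ← map_mul,
        inv₁_mul_form₁, map_one]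
    exact congrArg ofConv h
  map_comp_comul := by
    let iL : K ⊗[k] H →ₐ[k] (K ⊗[k] H) ⊗[k] (K ⊗[k] H) := Algebra.TensorProduct.includeLeft
    let iR : K ⊗[k] H →ₐ[k] (K ⊗[k] H) ⊗[k] (K ⊗[k] H) := Algebra.TensorProduct.includeRight
    have hc : push (Bialgebra.comulAlgHom k (K ⊗[k] H))
        (toConv (TensorProduct.comm k H K).toLinearMap) =
        push iL (toConv (TensorProduct.comm k H K).toLinearMap) *
          push iR (toConv (TensorProduct.comm k H K).toLinearMap) := by
      rw [incl_mul_incl]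
      refine ext_tmul fun x y => ?_
      simp only [LinearMap.comp_apply]
      simp [← (ℛ k x).eq, ← (ℛ k y).eq, TensorProduct.sum_tmul, TensorProduct.tmul_sum]
      exact Finset.sum_comm
    -- For the flip c, Δ turns R⁻¹ * c * R into R⁻¹ * c' * c'' * R, with c' and c'' the two copies
    -- of c. Inserting R * R⁻¹ = 1 in the middle splits it into the two copies of the exchange map.
    have h : push (Bialgebra.comulAlgHom k (K ⊗[k] H)) (toConv (bowtieExchange π R)) =
        push iL (toConv (bowtieExchange π R)) * push iR (toConv (bowtieExchange π R)) := by
      have e : scalar ((K ⊗[k] H) ⊗[k] (K ⊗[k] H)) (R.form₁ π) *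
          scalar ((K ⊗[k] H) ⊗[k] (K ⊗[k] H)) (R.inv₁ π) = 1 := by
        rw [← map_mul, form₁_mul_inv₁, map_one]
      simp only [bowtieExchange_eq, map_mul, push_scalar, hc, mul_assoc]
      rw [← mul_assoc (scalar _ (R.form₁ π)) (scalar _ (R.inv₁ π)), e, one_mul]
    rw [incl_mul_incl] at h
    exact (congrArg ofConv h).symm

/-- `x ⊗ h ↦ S(h) S(x)` in `K ⋈_R H`. -/
def bowtieAntipode : K ⊗[k] H →ₗ[k] K ⊗[k] H :=
  bowtieExchange π R ∘ₗ TensorProduct.map (HopfAlgebra.antipode k) (HopfAlgebra.antipode k) ∘ₗ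
    (TensorProduct.comm k K H).toLinearMap

theorem bowtieAct_antipode (x : K) (h : H) :
    R.bowtieAct π (R.bowtieAntipode π (x ⊗ₜ h)) =
      R.twistedAct π (HopfAlgebra.antipode k h) * mulAct k K H (HopfAlgebra.antipode k x) :=
  R.bowtieAct_exchange π _ _

theorem bowtieAct_one : R.bowtieAct π (1 ⊗ₜ 1) = 1 := by
  rw [bowtieAct_tmul, map_one, map_one, one_mul]

/-- In the representation the expression is S(h₁)S(x₁)x₂h₂, which collapses from the inside: first
the two factors from K, then those from H. -/
theorem bowtie_antipode_left (a : K ⊗[k] H) :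
    R.bowtieAct π (crossedMul (LinearMap.mul' k K) (LinearMap.mul' k H) (bowtieExchange π R)
      ((R.bowtieAntipode π).rTensor (K ⊗[k] H) (comul (R := k) a))) =
      counit (R := k) a • (1 : OpTensor k K H) := by
  induction a using TensorProduct.induction_on with
  | zero => simp
  | add a b ha hb => simp only [map_add, ha, hb, add_smul]
  | tmul x h =>
    rw [← ((ℛ k x).tmul (ℛ k h)).eq]
    simp only [Repr.tmul_index, Repr.tmul_left, Repr.tmul_right, map_sum, LinearMap.rTensor_tmul,
      bowtieAct_mul, bowtieAct_antipode, bowtieAct_tmul, Finset.sum_product_right]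
    have e : ∀ (a b : K) (c d : H), R.twistedAct π c * mulAct k K H a *
        (mulAct k K H b * R.twistedAct π d) =
        R.twistedAct π c * (mulAct k K H (a * b) * R.twistedAct π d) := fun a b c d => by
      simp only [map_mul, mul_assoc]
    simp only [e, ← Finset.mul_sum, ← Finset.sum_mul, ← map_sum,
      HopfAlgebra.sum_antipode_mul_eq_smul, map_smul, map_one, smul_mul_assoc, one_mul,
      mul_smul_comm, ← map_mul, ← Finset.smul_sum]
    simp [smul_smul, mul_comm]

theorem bowtie_antipode_right (a : K ⊗[k] H) :
    R.bowtieAct π (crossedMul (LinearMap.mul' k K) (LinearMap.mul' k H) (bowtieExchange π R)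
      ((R.bowtieAntipode π).lTensor (K ⊗[k] H) (comul (R := k) a))) =
      counit (R := k) a • (1 : OpTensor k K H) := by
  induction a using TensorProduct.induction_on with
  | zero => simp
  | add a b ha hb => simp only [map_add, ha, hb, add_smul]
  | tmul x h =>
    rw [← ((ℛ k x).tmul (ℛ k h)).eq]
    simp only [Repr.tmul_index, Repr.tmul_left, Repr.tmul_right, map_sum, LinearMap.lTensor_tmul,
      bowtieAct_mul, bowtieAct_antipode, bowtieAct_tmul, Finset.sum_product]
    have e : ∀ (a b : K) (c d : H), mulAct k K H a * R.twistedAct π c *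
        (R.twistedAct π d * mulAct k K H b) =
        mulAct k K H a * (R.twistedAct π (c * d) * mulAct k K H b) := fun a b c d => by
      simp only [map_mul, mul_assoc]
    simp only [e, ← Finset.mul_sum, ← Finset.sum_mul, ← map_sum,
      HopfAlgebra.sum_mul_antipode_eq_smul, map_smul, map_one, smul_mul_assoc, one_mul,
      mul_smul_comm, ← map_mul, ← Finset.smul_sum]
    simp [smul_smul, mul_comm]

/-- The coalgebra axioms are those of K ⊗ H; the algebra and antipode axioms are pulled back along
the injective representation. -/
theorem bowtie_isHopf : (bowtie π R (R.bowtieAntipode π)).IsHopf where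
  mul_assoc a b c := R.bowtieAct_injective π <| by
    simp only [bowtie, bowtieAct_mul, mul_assoc]
  one_mul a := R.bowtieAct_injective π <| by
    simp only [bowtie, bowtieAct_mul, bowtieAct_one, one_mul]
  mul_one a := R.bowtieAct_injective π <| by
    simp only [bowtie, bowtieAct_mul, bowtieAct_one, mul_one]
  coassoc := coassoc_apply
  counit_comul := rTensor_counit_comul
  comul_counit := lTensor_counit_comul
  comul_mul := comul_crossedMul (Bialgebra.mulCoalgHom k K) (Bialgebra.mulCoalgHom k H)
    (R.exchangeHom π)
  comul_one := by simp [bowtie, Algebra.TensorProduct.one_def]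
  counit_mul := counit_crossedMul (Bialgebra.mulCoalgHom k K) (Bialgebra.mulCoalgHom k H)
    (R.exchangeHom π)
  counit_one := by simp [bowtie]
  antipode_left a := R.bowtieAct_injective π <| by
    rw [map_smul]
    exact (R.bowtie_antipode_left π a).trans (congrArg _ (R.bowtieAct_one π).symm)
  antipode_right a := R.bowtieAct_injective π <| by
    rw [map_smul]
    exact (R.bowtie_antipode_right π a).trans (congrArg _ (R.bowtieAct_one π).symm)

end Coquasitriangular

/-! ### Iterated coproducts as sums, and maps of Hopf algebras -/

theorem comul₃_eq_sum_left {k C : Type*} [CommRing k] [AddCommGroup C] [Module k C] [Coalgebra k C]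
    {ι : Type*} {c : C} (r : Repr k c ι) :
    comul₃ k C c = ∑ i ∈ r.index,
      TensorProduct.assoc k C C C (comul (r.left i) ⊗ₜ r.right i) := by
  change comul.lTensor C (comul c) = _
  rw [← coassoc_apply, ← r.eq]
  simp

/-- The counterpart that splits the right factor is `comul₃_eq_sum_sum`. Coassociativity is used
below by evaluating one trilinear map on `comul₃` in both ways. -/
theorem comul₃_eq_sum_sum_left {k C : Type*} [CommRing k] [AddCommGroup C] [Module k C]
    [Coalgebra k C] (c : C) :
    comul₃ k C c = ∑ i ∈ (ℛ k c).index, ∑ j ∈ (ℛ k ((ℛ k c).left i)).index,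
      (ℛ k ((ℛ k c).left i)).left j ⊗ₜ ((ℛ k ((ℛ k c).left i)).right j ⊗ₜ (ℛ k c).right i) := by
  rw [comul₃_eq_sum_left (ℛ k c)]
  refine Finset.sum_congr rfl fun i _ => ?_
  conv_lhs => rw [← (ℛ k ((ℛ k c).left i)).eq]
  simp [TensorProduct.sum_tmul]

theorem comul₃_eq_sum_sum {k C : Type*} [CommRing k] [AddCommGroup C] [Module k C]
    [Coalgebra k C] (c : C) :
    comul₃ k C c = ∑ i ∈ (ℛ k c).index, ∑ j ∈ (ℛ k ((ℛ k c).right i)).index,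
      (ℛ k c).left i ⊗ₜ ((ℛ k ((ℛ k c).right i)).left j ⊗ₜ (ℛ k ((ℛ k c).right i)).right j) := by
  rw [comul₃_eq_sum (ℛ k c)]
  refine Finset.sum_congr rfl fun i _ => ?_
  conv_lhs => rw [← (ℛ k ((ℛ k c).right i)).eq]
  simp [TensorProduct.tmul_sum]

/-- A map of Hopf algebras preserves the antipode. -/
theorem map_antipode {k H K : Type*} [CommRing k] [Ring H] [HopfAlgebra k H] [Ring K]
    [HopfAlgebra k K] (f : H →ₐc[k] K) (x : H) :
    f (HopfAlgebra.antipode k x) = HopfAlgebra.antipode k (f x) := by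
  have h₁ : pull (f : H →ₗc[k] K) (toConv (HopfAlgebra.antipode k (A := K))) *
      hom (f : H →ₐ[k] K) = 1 :=
    ((pull (f : H →ₗc[k] K)).map_mul _ (toConv LinearMap.id)).symm.trans
      ((congrArg _ LinearMap.antipode_mul_id).trans (map_one _))
  exact congrArg (fun F : WithConv (H →ₗ[k] K) => F x)
    (left_inv_eq_right_inv h₁ (hom_mul_homInv (f : H →ₐ[k] K))).symm

/-! ### Hopf algebras that satisfy the exchange relation: the smash product relation and the product
of H_R -/

namespace Coquasitriangular

variable {k K H : Type*} [CommRing k] [Ring K] [HopfAlgebra k K] [Ring H] [HopfAlgebra k H]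
  (R : Coquasitriangular k K) (π : H →ₐc[k] K)

section Contract

variable (M : Type*) {N : Type*} [AddCommGroup M] [Module k M] [AddCommGroup N] [Module k N]

/-- `z ↦ (m ⊗ y ↦ R(y, z) m)` -/
def contract : K →ₗ[k] M ⊗[k] K →ₗ[k] M :=
  (TensorProduct.curry ((TensorProduct.rid k M).toLinearMap ∘ₗ R.form.lTensor M ∘ₗ
    (TensorProduct.assoc k M K K).toLinearMap)).flip

variable {M}

@[simp] theorem contract_tmul (z y : K) (m : M) :
    R.contract M z (m ⊗ₜ y) = R.form (y ⊗ₜ z) • m := by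
  simp [contract]

theorem braiding_eq_sum (δM : M →ₗ[k] M ⊗[k] K) (δN : N →ₗ[k] N ⊗[k] K) (m : M) {n : N}
    {ι : Type*} (s : Finset ι) (f : ι → N) (g : ι → K) (h : δN n = ∑ i ∈ s, f i ⊗ₜ g i) :
    R.braiding δM δN (m ⊗ₜ n) = ∑ i ∈ s, f i ⊗ₜ R.contract M (g i) (δM m) := by
  simp only [Coquasitriangular.braiding, LinearMap.comp_apply, TensorProduct.map_tmul, h]
  induction δM m using TensorProduct.induction_on with
  | zero => simp
  | add x y hx hy =>
    simp only [TensorProduct.add_tmul, map_add, hx, hy, TensorProduct.tmul_add,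
      Finset.sum_add_distrib]
  | tmul a b => simp [TensorProduct.tmul_sum]

theorem map_contract {A : Type*} [AddCommGroup A] [Module k A] (f : M →ₗ[k] A) (z : K)
    (t : M ⊗[k] K) : f (R.contract M z t) = R.contract A z (f.rTensor K t) := by
  induction t using TensorProduct.induction_on with
  | zero => simp
  | add x y hx hy => simp only [map_add, hx, hy]
  | tmul a b => simp

end Contract

variable {A : Type*} [Ring A] [Algebra k A]

/-- `R(π(S(a₍₁₎) a₍₃₎), x) f(a₍₂₎)` as a convolution product. -/
theorem contract_adCoaction (f : WithConv (H →ₗ[k] A)) (a : H) (x : K) :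
    f (R.contract H x (adCoaction π a)) =
      (scalar A (R.inv₁ π) * (fst f * scalar A (R.form₁ π)) :
        WithConv (H ⊗[k] K →ₗ[k] A)) (a ⊗ₜ x) := by
  rw [mul_tmul_apply _ _ (ℛ k a) (ℛ k x)]
  simp only [fst_mul_apply _ _ (ℛ k _), adCoaction, LinearMap.comp_apply, comul₃_eq_sum_sum,
    map_sum, adKernel_tmul, contract_tmul, map_smul]
  refine Finset.sum_congr rfl fun i _ => ?_
  simp only [Finset.mul_sum]
  rw [Finset.sum_comm]
  refine Finset.sum_congr rfl fun j _ => ?_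
  rw [map_mul, R.form_mul_left _ _ (ℛ k x), Finset.sum_smul]
  refine Finset.sum_congr rfl fun l _ => ?_
  simp only [scalar_apply, inv₁_tmul, form₁_tmul, inv_apply, map_antipode,
    ← Algebra.commutes, ← Algebra.smul_def, smul_smul]

variable {B : Type*} [Ring B] [HopfAlgebra k B] (i : K →ₐc[k] B) (j : H →ₐc[k] B)

/-- The relation `j(h) i(x) = R⁻¹(π(h₍₁₎), x₍₁₎) i(x₍₂₎) j(h₍₂₎) R(π(h₍₃₎), x₍₃₎)`. -/
def ExchangeRel : Prop :=
  fst (hom (j : H →ₐ[k] B)) * snd (hom (i : K →ₐ[k] B)) =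
    scalar B (R.inv₁ π) * (snd (hom (i : K →ₐ[k] B)) * fst (hom (j : H →ₐ[k] B))) *
      scalar B (R.form₁ π)

/-- `h ↦ i(π(h))` -/
abbrev base : H →ₐ[k] B := (i : K →ₐ[k] B).comp (π : H →ₐ[k] K)

/-- `h ↦ i(π(S(h₍₁₎))) j(h₍₂₎)` -/
def incl : WithConv (H →ₗ[k] B) := homInv (base π i) * hom (j : H →ₐ[k] B)

theorem base_mul_incl : hom (base π i) * incl π i j = hom (j : H →ₐ[k] B) := by
  rw [incl, ← mul_assoc, hom_mul_homInv, one_mul]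

variable {R π i j}

/-- The smash product relation. Moving i(x) to the left past j(h₂) produces R⁻¹ and R around the
product; quasi-commutativity in K then moves the remaining factor iπ(S(h₁)) past R⁻¹ and i(x). What
is left is the contraction of R with the adjoint coaction (`contract_adCoaction`). -/
theorem ExchangeRel.incl_mul (h : R.ExchangeRel π i j) :
    fst (incl π i j) * snd (hom (i : K →ₐ[k] B)) =
      snd (hom (i : K →ₐ[k] B)) *
        (scalar B (R.inv₁ π) * (fst (incl π i j) * scalar B (R.form₁ π))) := by
  -- Multiplying by the inverse of iπ on both sides turns the commutation rule for iπ into one for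
  -- iπ∘S.
  have h₁ := congrArg (fun F => fst (homInv (base π i)) * F * fst (homInv (base π i)))
    (R.inv₁_snd_fst π (i : K →ₐ[k] B))
  have e₁ : (fst (hom (base π i)) * fst (homInv (base π i)) :
      WithConv (H ⊗[k] K →ₗ[k] B)) = 1 := by rw [← map_mul, hom_mul_homInv, map_one]
  have e₂ : (fst (homInv (base π i)) * fst (hom (base π i)) :
      WithConv (H ⊗[k] K →ₗ[k] B)) = 1 := by rw [← map_mul, homInv_mul_hom, map_one]
  simp only [mul_assoc, e₁, mul_one] at h₁
  rw [← mul_assoc (fst (homInv (base π i))) (fst (hom (base π i))), e₂, one_mul] at h₁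
  have h₂ : fst (hom (j : H →ₐ[k] B)) * snd (hom (i : K →ₐ[k] B)) = _ := h
  rw [incl, map_mul, mul_assoc, h₂]
  simp only [← mul_assoc] at h₁ ⊢
  rw [h₁]

/-- The linear map `x ⊗ a ↦ i(x) i(π(S(a₍₁₎))) j(a₍₂₎)`. -/
def toBosonized (π : H →ₐc[k] K) (i : K →ₐc[k] B) (j : H →ₐc[k] B) : K ⊗[k] H →ₗ[k] B :=
  LinearMap.mul' k B ∘ₗ TensorProduct.map (i : K →ₗ[k] B) (incl π i j).ofConv

@[simp] theorem toBosonized_tmul (x : K) (a : H) :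
    toBosonized π i j (x ⊗ₜ a) = i x * incl π i j a := rfl

theorem ExchangeRel.incl_mul_apply (h : R.ExchangeRel π i j) (a : H) {ι : Type*} {x : K}
    (r : Repr k x ι) : incl π i j a * i x =
      ∑ l ∈ r.index, i (r.left l) * incl π i j (R.contract H (r.right l) (adCoaction π a)) := by
  have := congrArg (fun F : WithConv (H ⊗[k] K →ₗ[k] B) => F (a ⊗ₜ x)) h.incl_mul
  simp only [fst_mul_snd_apply, snd_mul_apply _ _ a r, ← contract_adCoaction] at this
  exact this

/-- The exchange map of the smash product is the braiding of H_R with K coacting on itself by Δ;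
this is the hypothesis on τ in `map_crossedMul`. -/
theorem ExchangeRel.toBosonized_braiding (h : R.ExchangeRel π i j) (a : H) (x : K) :
    toBosonized π i j (R.braiding (adCoaction π) comul (a ⊗ₜ x)) = incl π i j a * i x := by
  rw [h.incl_mul_apply a (ℛ k x),
    R.braiding_eq_sum (adCoaction π) comul a (ℛ k x).index _ _ (ℛ k x).eq.symm]
  simp

variable (R π) in
/-- The product of the transmutation in terms of the adjoint coaction. -/
theorem transmutation_mul_eq (x y : H) :
    (transmutation π R).mul (x ⊗ₜ y) = ∑ l ∈ (ℛ k y).index,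
      R.contract H (π (HopfAlgebra.antipode k ((ℛ k y).left l))) (adCoaction π x) *
        (ℛ k y).right l := by
  simp only [transmutation, LinearMap.comp_apply, TensorProduct.map_tmul, adCoaction]
  generalize comul₃ k H x = t
  induction t using TensorProduct.induction_on with
  | zero => simp
  | add s t hs ht => simp only [TensorProduct.add_tmul, map_add, hs, ht, add_mul,
      Finset.sum_add_distrib]
  | tmul a u =>
    induction u using TensorProduct.induction_on with
    | zero => simp
    | add s t hs ht => simp only [TensorProduct.add_tmul, TensorProduct.tmul_add, map_add, hs, ht,
        add_mul, Finset.sum_add_distrib]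
    | tmul b c =>
      rw [comul₃_eq_sum_sum_left]
      simp only [TensorProduct.tmul_sum, map_sum, transmutationMulKernel_tmul, adKernel_tmul,
        contract_tmul]
      refine Finset.sum_congr rfl fun l _ => ?_
      -- R(π(S(a)c), πS(y)) splits as R(πS(a), πS(y₂)) R(π(c), πS(y₁)), and the first factor equals
      -- R(π(a), π(y₂)) because R is invariant under S ⊗ S.
      rw [map_mul, R.form_mul_left _ _ ((ℛ k ((ℛ k y).left l)).antipode.induced π),
        Finset.sum_smul, Finset.sum_mul]
      refine Finset.sum_congr rfl fun m _ => ?_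
      simp [map_antipode, form_antipode_antipode, mul_comm]

theorem incl_mul_eq_sum (x : H) {ι : Type*} {y : H} (r : Repr k y ι) :
    incl π i j (x * y) = ∑ l ∈ r.index,
      base π i (HopfAlgebra.antipode k (r.left l)) * incl π i j x * j (r.right l) := by
  rw [incl, ((ℛ k x).mul r).convMul_apply, (ℛ k x).convMul_apply]
  simp only [Repr.mul_index, Repr.mul_left, Repr.mul_right, Finset.sum_product_right]
  refine Finset.sum_congr rfl fun l _ => ?_
  rw [Finset.mul_sum, Finset.sum_mul]
  refine Finset.sum_congr rfl fun m _ => ?_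
  simp [HopfAlgebra.antipode_mul_antidistrib, mul_assoc]

/-- The product of H_R is forced by B. In ι(x)ι(y) = ι(x) iπ(S(y₁)) j(y₂), moving the middle factor
to the left past ι(x) by the smash product relation gives a sum over y₁ ⊗ y₂ ⊗ y₃. Expanding ι of
the product of H_R through `incl_mul_eq_sum` gives the same sum. -/
theorem ExchangeRel.incl_transmutation_mul (h : R.ExchangeRel π i j) (x y : H) :
    incl π i j ((transmutation π R).mul (x ⊗ₜ y)) = incl π i j x * incl π i j y := by
  -- The first two tensor factors are exchanged because Δ(S(y)) = S(y₂) ⊗ S(y₁).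
  let T : H ⊗[k] (H ⊗[k] H) →ₗ[k] B :=
    triple (homInv (base π i)) (toConv ((incl π i j).ofConv ∘ₗ (R.contract H).flip
      (adCoaction π x) ∘ₗ (π : H →ₗ[k] K) ∘ₗ HopfAlgebra.antipode k)) (hom (j : H →ₐ[k] B)) ∘ₗ
      (TensorProduct.leftComm k H H H).toLinearMap
  have hT : ∀ a b c : H, T (a ⊗ₜ (b ⊗ₜ c)) = base π i (HopfAlgebra.antipode k b) *
      (incl π i j (R.contract H (π (HopfAlgebra.antipode k a)) (adCoaction π x)) * j c) :=
    fun a b c => by simp [T]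
  trans T (comul₃ k H y)
  · rw [transmutation_mul_eq, comul₃_eq_sum_sum]
    simp only [map_sum, hT]
    refine Finset.sum_congr rfl fun l _ => ?_
    rw [incl_mul_eq_sum _ (ℛ k ((ℛ k y).right l))]
    simp only [mul_assoc]
  · rw [comul₃_eq_sum_sum_left]
    simp only [map_sum, hT]
    nth_rw 3 [incl]
    rw [(ℛ k y).convMul_apply, Finset.mul_sum]
    refine Finset.sum_congr rfl fun l _ => ?_
    have e := h.incl_mul_apply x ((ℛ k ((ℛ k y).left l)).antipode.induced π)
    rw [homInv_apply, ← mul_assoc]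
    refine Eq.trans ?_ (congrArg (· * j ((ℛ k y).right l)) e.symm)
    simp [Finset.sum_mul, mul_assoc]

end Coquasitriangular

namespace Coquasitriangular

variable {k K H : Type*} [CommRing k] [Ring K] [HopfAlgebra k K] [Ring H] [HopfAlgebra k H]
  {R : Coquasitriangular k K} {π : H →ₐc[k] K}
  {B : Type*} [Ring B] [HopfAlgebra k B] {i : K →ₐc[k] B} {j : H →ₐc[k] B}

/-! ### The coproduct -/

/-- Makes the adjoint coaction a conjugate: the first leg multiplied by the inverse of π on the left
and by π on the right, both placed in the second leg. Comodule identities then become cancellations.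
-/
theorem map_adCoaction {A A' : Type*} [Ring A] [Algebra k A] [Ring A'] [Algebra k A']
    (f : WithConv (H →ₗ[k] A)) (g : K →ₐ[k] A') :
    toConv (TensorProduct.map f.ofConv g.toLinearMap ∘ₗ adCoaction π) =
      push (Algebra.TensorProduct.includeRight : A' →ₐ[k] A ⊗[k] A')
          (homInv (g.comp (π : H →ₐ[k] K))) *
        push (Algebra.TensorProduct.includeLeft : A →ₐ[k] A ⊗[k] A') f *
        push (Algebra.TensorProduct.includeRight : A' →ₐ[k] A ⊗[k] A')
          (hom (g.comp (π : H →ₐ[k] K))) := by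
  refine ext_apply fun x => ?_
  rw [mul_mul_apply]
  refine LinearMap.congr_fun (?_ : TensorProduct.map f.ofConv g.toLinearMap ∘ₗ adKernel π = _) _
  refine TensorProduct.ext_threefold' fun a b c => ?_
  rw [LinearMap.comp_apply, adKernel_tmul]
  simp

/-- Δ(iπ(S(a₁)) j(a₂)) has one copy of ι in the first leg, enclosed by iπ∘S and j in the second.
Inserting iπ * (iπ∘S) = 1 in the second leg separates the adjoint coaction from another ι. -/
theorem comul_incl (a : H) : comul (R := k) (incl π i j a) =
    (LinearMap.mul' k (B ⊗[k] B) ∘ₗ TensorProduct.map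
      (TensorProduct.map (incl π i j).ofConv (i : K →ₐ[k] B).toLinearMap)
      (Algebra.TensorProduct.includeRight.toLinearMap ∘ₗ (incl π i j).ofConv))
      ((adCoaction π).rTensor H (comul a)) := by
  let iL : B →ₐ[k] B ⊗[k] B := Algebra.TensorProduct.includeLeft
  let iR : B →ₐ[k] B ⊗[k] B := Algebra.TensorProduct.includeRight
  have hp : push (Bialgebra.comulAlgHom k B) (homInv (base π i)) =
      push iR (homInv (base π i)) * push iL (homInv (base π i)) := by
    refine Eq.trans ?_ (homInv_comp_comul (iL.comp (base π i)) (iR.comp (base π i))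
      (Algebra.TensorProduct.map (base π i) (base π i)) (by simp [iL, iR]))
    refine ext_apply fun x => ?_
    have := CoalgHomClass.map_comp_comul_apply (R := k) (i.comp π) (HopfAlgebra.antipode k x)
    exact this.symm
  have hj : push (Bialgebra.comulAlgHom k B) (hom (j : H →ₐ[k] B)) =
      push iL (hom (j : H →ₐ[k] B)) * push iR (hom (j : H →ₐ[k] B)) := by
    rw [incl_mul_incl]
    refine ext_apply fun x => ?_
    exact (CoalgHomClass.map_comp_comul_apply (R := k) j x).symm
  have key : push (Bialgebra.comulAlgHom k B) (incl π i j) =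
      toConv (TensorProduct.map (incl π i j).ofConv (i : K →ₐ[k] B).toLinearMap ∘ₗ
        adCoaction π) * push iR (incl π i j) := by
    have e : push iR (hom (base π i)) * push iR (homInv (base π i)) = 1 := by
      rw [← map_mul, hom_mul_homInv, map_one]
    rw [map_adCoaction, incl, map_mul, hp, hj]
    simp only [map_mul, mul_assoc]
    rw [← mul_assoc (push _ (hom ((i : K →ₐ[k] B).comp (π : H →ₐ[k] K)))), e, one_mul]
  refine (congrArg (fun F : WithConv (H →ₗ[k] B ⊗[k] B) => F a) key).trans ?_
  rw [(ℛ k a).convMul_apply, ← (ℛ k a).eq]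
  simp [iR]

theorem comul_toBosonized (t : K ⊗[k] H) : comul (R := k) (toBosonized π i j t) =
    TensorProduct.map (toBosonized π i j) (toBosonized π i j)
      (((transmutation π R).bosonization R).comul t) := by
  induction t using TensorProduct.induction_on with
  | zero => simp
  | add s t hs ht => simp only [map_add, hs, ht]
  | tmul x a =>
    rw [toBosonized_tmul, Bialgebra.comul_mul, comul_incl,
      ← CoalgHomClass.map_comp_comul_apply (R := k) i x]
    simp only [BraidedHopfData.bosonization, transmutation, LinearMap.comp_apply,
      TensorProduct.map_tmul]
    generalize (adCoaction π).rTensor H (comul a) = u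
    induction comul (R := k) x using TensorProduct.induction_on with
    | zero => simp
    | add s t hs ht => simp only [map_add, TensorProduct.add_tmul, hs, ht, add_mul]
    | tmul x₁ x₂ =>
      induction u using TensorProduct.induction_on with
      | zero => simp
      | add s t hs ht => simp only [map_add, TensorProduct.tmul_add, hs, ht, mul_add]
      | tmul s c =>
        induction s using TensorProduct.induction_on with
        | zero => simp
        | add s t hs ht => simp only [map_add, TensorProduct.tmul_add, TensorProduct.add_tmul,
            hs, ht, mul_add]
        | tmul b y =>
          rw [BraidedHopfData.cosmash_tmul]
          simp [mul_assoc]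

theorem counit_incl (a : H) : counit (R := k) (incl π i j a) = counit (R := k) a := by
  have h : push (Bialgebra.counitAlgHom k B) (incl π i j) = 1 := by
    have h₁ : push (Bialgebra.counitAlgHom k B) (homInv (base π i)) = 1 :=
      ext_apply fun x => by simp
    have h₂ : push (Bialgebra.counitAlgHom k B) (hom (j : H →ₐ[k] B)) = 1 :=
      ext_apply fun x => by simp
    rw [incl, map_mul, h₁, h₂, one_mul]
  exact congrArg (fun F : WithConv (H →ₗ[k] k) => F a) h

/-! ### The antipode -/

/-- `x ↦ F(S(x₍₁₎) ⊗ π(x₍₂₎))` -/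
def antidiag {A : Type*} [Ring A] [Algebra k A] (π : H →ₐc[k] K)
    (F : WithConv (H ⊗[k] K →ₗ[k] A)) : WithConv (H →ₗ[k] A) :=
  toConv (F.ofConv ∘ₗ TensorProduct.map (HopfAlgebra.antipode k) (π : H →ₗ[k] K) ∘ₗ comul)

theorem antidiag_apply {A : Type*} [Ring A] [Algebra k A] (F : WithConv (H ⊗[k] K →ₗ[k] A))
    {ι : Type*} {x : H} (r : Repr k x ι) : antidiag π F x =
      ∑ l ∈ r.index, F (HopfAlgebra.antipode k (r.left l) ⊗ₜ π (r.right l)) := by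
  simp [antidiag, ← r.eq]

/-- Both sides are Φ((x₂ ⊗ x₃) ⊗ (x₁ ⊗ x₄)): the left halves the coproduct and halves again, while
the right peels off the outer factors first. -/
theorem sum_comul_comul {V : Type*} [AddCommGroup V] [Module k V]
    (Φ : (H ⊗[k] H) ⊗[k] (H ⊗[k] H) →ₗ[k] V) (x : H) :
    ∑ l ∈ (ℛ k x).index, ∑ m ∈ (ℛ k ((ℛ k x).left l)).index,
      ∑ n ∈ (ℛ k ((ℛ k x).right l)).index,
        Φ (((ℛ k ((ℛ k x).left l)).right m ⊗ₜ (ℛ k ((ℛ k x).right l)).left n) ⊗ₜ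
          ((ℛ k ((ℛ k x).left l)).left m ⊗ₜ (ℛ k ((ℛ k x).right l)).right n)) =
    ∑ l ∈ (ℛ k x).index, ∑ m ∈ (ℛ k ((ℛ k x).right l)).index,
      Φ (comul ((ℛ k ((ℛ k x).right l)).left m) ⊗ₜ
        ((ℛ k x).left l ⊗ₜ (ℛ k ((ℛ k x).right l)).right m)) := by
  let T : H ⊗[k] (H ⊗[k] (H ⊗[k] H)) →ₗ[k] V := Φ ∘ₗ
    (TensorProduct.assoc k H H (H ⊗[k] H)).symm.toLinearMap ∘ₗ
    (TensorProduct.leftComm k H H H).toLinearMap.lTensor H ∘ₗ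
    (TensorProduct.leftComm k H H (H ⊗[k] H)).toLinearMap
  have hT : ∀ a b c d : H, T (a ⊗ₜ (b ⊗ₜ (c ⊗ₜ d))) = Φ ((b ⊗ₜ c) ⊗ₜ (a ⊗ₜ d)) :=
    fun a b c d => by simp [T]
  let T' : H ⊗[k] (H ⊗[k] H) →ₗ[k] V := T ∘ₗ (comul.lTensor H).lTensor H
  have hT' : ∀ a b c : H, T' (a ⊗ₜ (b ⊗ₜ c)) = ∑ n ∈ (ℛ k c).index,
      Φ ((b ⊗ₜ (ℛ k c).left n) ⊗ₜ (a ⊗ₜ (ℛ k c).right n)) := fun a b c => by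
    simp only [T', LinearMap.comp_apply, LinearMap.lTensor_tmul, ← hT]
    conv_lhs => rw [← (ℛ k c).eq]
    simp only [TensorProduct.tmul_sum, map_sum]
  trans T' (comul₃ k H x)
  · simp only [comul₃_eq_sum_sum_left, map_sum, hT']
  · rw [comul₃_eq_sum (ℛ k x), map_sum]
    refine Finset.sum_congr rfl fun l _ => ?_
    change T ((ℛ k x).left l ⊗ₜ comul₃ k H ((ℛ k x).right l)) = _
    rw [comul₃_eq_sum_sum_left]
    simp only [TensorProduct.tmul_sum, map_sum, hT]
    refine Finset.sum_congr rfl fun m _ => ?_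
    rw [← map_sum, ← TensorProduct.sum_tmul, (ℛ k ((ℛ k ((ℛ k x).right l)).left m)).eq]

/-- As S reverses the coproduct, the factors nest instead of lining up: F sees x₂ and x₃, G sees x₁
and x₄. -/
theorem antidiag_mul {A : Type*} [Ring A] [Algebra k A] (F G : WithConv (H ⊗[k] K →ₗ[k] A))
    (x : H) : antidiag π (F * G) x =
      ∑ l ∈ (ℛ k x).index, ∑ m ∈ (ℛ k ((ℛ k x).right l)).index,
        antidiag π F ((ℛ k ((ℛ k x).right l)).left m) *
          G (HopfAlgebra.antipode k ((ℛ k x).left l) ⊗ₜ π ((ℛ k ((ℛ k x).right l)).right m)) := by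
  let Φ : (H ⊗[k] H) ⊗[k] (H ⊗[k] H) →ₗ[k] A := LinearMap.mul' k A ∘ₗ TensorProduct.map
    (F.ofConv ∘ₗ TensorProduct.map (HopfAlgebra.antipode k) (π : H →ₗ[k] K))
    (G.ofConv ∘ₗ TensorProduct.map (HopfAlgebra.antipode k) (π : H →ₗ[k] K))
  refine Eq.trans ?_ (sum_comul_comul Φ x)
  rw [antidiag_apply _ (ℛ k x)]
  refine Finset.sum_congr rfl fun l _ => ?_
  rw [mul_tmul_apply _ _ (ℛ k ((ℛ k x).left l)).antipode
    ((ℛ k ((ℛ k x).right l)).induced π)]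
  rfl

/-- A linear map regarded as a map to the opposite algebra. -/
def toOp {A : Type*} [Ring A] [Algebra k A] (f : WithConv (H →ₗ[k] A)) :
    WithConv (H →ₗ[k] Aᵐᵒᵖ) :=
  toConv ((MulOpposite.opLinearEquiv k).toLinearMap ∘ₗ f.ofConv)

section Op

variable {A : Type*} [Ring A] [Algebra k A]

@[simp] theorem toOp_apply (f : WithConv (H →ₗ[k] A)) (x : H) :
    toOp f x = MulOpposite.op (f x) := rfl

theorem toOp_mul_apply (f g : WithConv (H →ₗ[k] A)) {ι : Type*} {x : H} (r : Repr k x ι) :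
    (toOp f * toOp g) x = MulOpposite.op (∑ l ∈ r.index, g (r.right l) * f (r.left l)) := by
  rw [r.convMul_apply]
  simp

theorem toOp_injective : Function.Injective (toOp : WithConv (H →ₗ[k] A) → _) := fun _ _ h =>
  ext_apply fun x => MulOpposite.op_injective
    (congrArg (fun F : WithConv (H →ₗ[k] Aᵐᵒᵖ) => F x) h)

theorem toOp_mul_scalar (f : WithConv (H →ₗ[k] A)) (s : WithConv (H →ₗ[k] k)) :
    toOp (f * scalar A s) = toOp f * scalar Aᵐᵒᵖ s :=
  comp_mul_scalar _ _ _

/-- `S²(x)` as a convolution inverse of `S(x)` in the opposite algebra. -/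
theorem toOp_antipode_antipode_mul (f : H →ₐ[k] A) :
    toOp (toConv (f.toLinearMap ∘ₗ HopfAlgebra.antipode k ∘ₗ HopfAlgebra.antipode k)) *
      toOp (homInv f) = 1 :=
  homInv_mul_hom ((AlgHom.op f).comp (HopfAlgebra.antipodeAlgHomOp k H))

end Op

variable (R π) in
/-- `x ↦ R(π(S²(x₍₁₎)), π(x₍₂₎))` -/
def drinfeld : WithConv (H →ₗ[k] k) := antidiag π (R.inv₁ π)

/-- `S²(x₍₁₎) u(x₍₂₎) = u(x₍₁₎) x₍₂₎` -/
theorem toOp_drinfeld_mul : toOp (scalar B (R.drinfeld π) * hom (base π i)) =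
    toOp (toConv ((base π i).toLinearMap ∘ₗ HopfAlgebra.antipode k ∘ₗ HopfAlgebra.antipode k)) *
      scalar _ (R.drinfeld π) := by
  -- `antidiag` is applied to both sides of quasi-commutativity. One side is u(x₂) iπ(x₃) iπ(S(x₁)),
  -- whose reversed order explains the opposite algebra; the other is u(x), because S(x₂)x₃
  -- collapses to a counit. Multiplying by S², the inverse of S there, solves for the claim.
  have h : toOp (homInv (base π i)) * toOp (scalar B (R.drinfeld π) * hom (base π i)) =
      scalar _ (R.drinfeld π) := by
    refine ext_apply fun x => ?_
    rw [toOp_mul_apply _ _ (ℛ k x)]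
    have e₁ : antidiag π (fst (hom (base π i)) * snd (hom (i : K →ₐ[k] B))) = 1 := by
      refine ext_apply fun x => ?_
      rw [antidiag_apply _ (ℛ k x), ← homInv_mul_hom (base π i), (ℛ k x).convMul_apply]
      exact Finset.sum_congr rfl fun l _ => fst_mul_snd_apply _ _ _ _
    have e := R.inv₁_snd_fst π (i : K →ₐ[k] B)
    rw [mul_assoc (scalar B (R.inv₁ π))] at e
    have hL := antidiag_mul (π := π) (scalar B (R.inv₁ π))
      (snd (hom (i : K →ₐ[k] B)) * fst (hom (base π i))) x
    rw [e, antidiag_mul, e₁] at hL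
    refine congrArg MulOpposite.op (Eq.trans ?_ (hL.symm.trans ?_))
    · refine Finset.sum_congr rfl fun l _ => ?_
      rw [(ℛ k ((ℛ k x).right l)).convMul_apply, Finset.sum_mul]
      refine Finset.sum_congr rfl fun m _ => ?_
      rw [snd_mul_fst_apply, mul_assoc]
      rfl
    · change _ = antidiag π (scalar B (R.inv₁ π)) x
      rw [antidiag_apply _ (ℛ k x)]
      refine Finset.sum_congr rfl fun l _ => ?_
      simp only [LinearMap.convOne_apply, ← Algebra.smul_def]
      exact sum_counit_smul_map (ℛ k ((ℛ k x).right l)) ((scalar B (R.inv₁ π)).ofConv ∘ₗ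
        TensorProduct.mk k H K (HopfAlgebra.antipode k ((ℛ k x).left l)) ∘ₗ (π : H →ₗ[k] K))
  rw [← h, ← mul_assoc, toOp_antipode_antipode_mul, one_mul]

variable (π i j) in
/-- `x ↦ j(S(x₍₁₎)) i(π(x₍₂₎))` -/
def inclInv : WithConv (H →ₗ[k] B) := homInv (j : H →ₐ[k] B) * hom (base π i)

@[simp] theorem incl_mul_inclInv : incl π i j * inclInv π i j = 1 := by
  rw [incl, inclInv, mul_assoc, ← mul_assoc (hom (j : H →ₐ[k] B)), hom_mul_homInv, one_mul,
    homInv_mul_hom]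

@[simp] theorem inclInv_mul_incl : inclInv π i j * incl π i j = 1 := by
  rw [incl, inclInv, mul_assoc, ← mul_assoc (hom (base π i)), hom_mul_homInv, one_mul,
    homInv_mul_hom]

theorem toOp_incl_antipode :
    toOp (toConv ((incl π i j).ofConv ∘ₗ HopfAlgebra.antipode k)) =
      toOp (homInv (j : H →ₐ[k] B)) * toOp (toConv ((base π i).toLinearMap ∘ₗ
        HopfAlgebra.antipode k ∘ₗ HopfAlgebra.antipode k)) := by
  refine ext_apply fun x => ?_
  rw [toOp_mul_apply _ _ (ℛ k x)]
  exact congrArg MulOpposite.op ((ℛ k x).antipode.convMul_apply _ _)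

/-- The left part of the exchange relation at S(x₁) ⊗ π(x₂) is u(x₂) iπ(x₃) j(S(x₁)). The functional
u moves past iπ at the price of S², and iπ(S²(x₂)) j(S(x₁)) is ι(S(x)). -/
theorem antidiag_exchange :
    antidiag π (scalar B (R.inv₁ π) *
      (snd (hom (i : K →ₐ[k] B)) * fst (hom (j : H →ₐ[k] B)))) =
    toConv ((incl π i j).ofConv ∘ₗ HopfAlgebra.antipode k) * scalar B (R.drinfeld π) := by
  refine toOp_injective ?_
  rw [toOp_mul_scalar, toOp_incl_antipode, mul_assoc, ← toOp_drinfeld_mul]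
  refine ext_apply fun x => ?_
  rw [toOp_mul_apply _ _ (ℛ k x), toOp_apply, antidiag_mul]
  refine congrArg MulOpposite.op (Finset.sum_congr rfl fun l _ => ?_)
  rw [(ℛ k ((ℛ k x).right l)).convMul_apply, Finset.sum_mul]
  refine Finset.sum_congr rfl fun m _ => ?_
  rw [snd_mul_fst_apply, mul_assoc]
  rfl

variable (R π) in
/-- `z ↦ R(π(S(a)), π(z))` -/
def formAntipode (a : H) : WithConv (H →ₗ[k] k) :=
  toConv (TensorProduct.curry R.form (π (HopfAlgebra.antipode k a)) ∘ₗ (π : H →ₗ[k] K))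

/-- Combines two R-factors by multiplicativity in the first argument into the single factor that
occurs in S_R. -/
theorem drinfeld_mul_formAntipode (a z : H) : (R.drinfeld π * R.formAntipode π a) z =
    ∑ l ∈ (ℛ k z).index, R.form (π (HopfAlgebra.antipode k (HopfAlgebra.antipode k
      ((ℛ k z).left l)) * HopfAlgebra.antipode k a) ⊗ₜ π ((ℛ k z).right l)) := by
  let f₁ : H →ₗ[k] H →ₗ[k] k := (TensorProduct.curry R.form).compl₁₂
    ((π : H →ₗ[k] K) ∘ₗ HopfAlgebra.antipode k ∘ₗ HopfAlgebra.antipode k) (π : H →ₗ[k] K)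
  let T : H ⊗[k] (H ⊗[k] H) →ₗ[k] k := LinearMap.mul' k k ∘ₗ
    TensorProduct.map (TensorProduct.lift f₁) (R.formAntipode π a).ofConv ∘ₗ
    (TensorProduct.assoc k H H H).symm.toLinearMap
  have hT : ∀ b c d : H, T (b ⊗ₜ (c ⊗ₜ d)) = R.form (π (HopfAlgebra.antipode k
      (HopfAlgebra.antipode k b)) ⊗ₜ π c) * R.formAntipode π a d := fun b c d => by
    simp [T, f₁]
  trans T (comul₃ k H z)
  · rw [(ℛ k z).convMul_apply, comul₃_eq_sum_sum_left]
    simp only [map_sum, hT, drinfeld, antidiag_apply _ (ℛ k _), Finset.sum_mul, inv₁_tmul,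
      inv_apply, map_antipode]
  · rw [comul₃_eq_sum_sum]
    simp only [map_sum, hT]
    refine Finset.sum_congr rfl fun l _ => ?_
    rw [map_mul, R.form_mul_left _ _ ((ℛ k ((ℛ k z).right l)).induced π)]
    rfl

theorem ExchangeRel.fst_mul_snd (h : R.ExchangeRel π i j) :
    fst (hom (j : H →ₐ[k] B)) * snd (hom (i : K →ₐ[k] B)) =
      scalar B (R.inv₁ π) * (snd (hom (i : K →ₐ[k] B)) * fst (hom (j : H →ₐ[k] B))) *
        scalar B (R.form₁ π) := h

theorem inclInv_eq_antidiag : inclInv π i j =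
    antidiag π (fst (hom (j : H →ₐ[k] B)) * snd (hom (i : K →ₐ[k] B))) := by
  refine ext_apply fun x => ?_
  rw [antidiag_apply _ (ℛ k x), inclInv, (ℛ k x).convMul_apply]
  refine Finset.sum_congr rfl fun l _ => ?_
  rw [fst_mul_snd_apply]
  rfl

/-- The image of `S_R(x)` is `j(S(x₍₁₎)) i(π(x₍₂₎))`. -/
theorem ExchangeRel.incl_transmutation_antipode (h : R.ExchangeRel π i j) (x : H) :
    incl π i j ((transmutation π R).antipode x) = inclInv π i j x := by
  -- The target j(S(x₁)) iπ(x₂) is the exchange relation evaluated antidiagonally. Its R⁻¹ yields u,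
  -- and its R becomes the outer factor in x₁ and x₄.
  rw [inclInv_eq_antidiag, ExchangeRel.fst_mul_snd h, antidiag_mul, antidiag_exchange]
  trans incl π i j (transmutationAntipodeKernel π R ((comul₃ k H).lTensor H (comul x)))
  · rfl
  conv_lhs => rw [← (ℛ k x).eq]
  simp only [map_sum, LinearMap.lTensor_tmul]
  refine Finset.sum_congr rfl fun l _ => ?_
  generalize (ℛ k x).left l = a
  generalize (ℛ k x).right l = y
  trans (toConv ((incl π i j).ofConv ∘ₗ HopfAlgebra.antipode k) *
    scalar B (R.drinfeld π * R.formAntipode π a)) y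
  · rw [comul₃_eq_sum_sum, mul_scalar_apply _ _ (ℛ k y)]
    simp only [TensorProduct.tmul_sum, map_sum, transmutationAntipodeKernel_tmul, map_smul,
      drinfeld_mul_formAntipode, Finset.sum_smul]
    rfl
  · rw [map_mul, ← mul_assoc, (ℛ k y).convMul_apply]
    rfl

end Coquasitriangular

/-! ### The map from the bosonization preserves the structure -/

namespace Coquasitriangular

variable {k K H : Type*} [CommRing k] [Ring K] [HopfAlgebra k K] [Ring H] [HopfAlgebra k H]
  {R : Coquasitriangular k K} {π : H →ₐc[k] K}
  {B : Type*} [Ring B] [HopfAlgebra k B] {i : K →ₐc[k] B} {j : H →ₐc[k] B}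

@[simp] theorem incl_one : incl π i j 1 = 1 := by
  rw [incl, (Repr.one k H).convMul_apply]
  simp

theorem ExchangeRel.toBosonized_mul (h : R.ExchangeRel π i j) (s t : K ⊗[k] H) :
    toBosonized π i j (((transmutation π R).bosonization R).mul (s ⊗ₜ t)) =
      toBosonized π i j s * toBosonized π i j t :=
  map_crossedMul (i := (i : K →ₗ[k] B)) (j := (incl π i j).ofConv)
    (fun _ _ => rfl) (fun x y => map_mul i x y) h.incl_transmutation_mul
    h.toBosonized_braiding s t

theorem toBosonized_one :
    toBosonized π i j ((transmutation π R).bosonization R).one = 1 := by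
  change toBosonized π i j (1 ⊗ₜ 1) = 1
  simp

theorem counit_toBosonized (t : K ⊗[k] H) : counit (R := k) (toBosonized π i j t) =
    ((transmutation π R).bosonization R).counit t := by
  induction t using TensorProduct.induction_on with
  | zero => simp
  | add s t hs ht => simp only [map_add, hs, ht]
  | tmul x a =>
    rw [toBosonized_tmul, Bialgebra.counit_mul, counit_incl,
      CoalgHomClass.counit_comp_apply]
    simp [BraidedHopfData.bosonization, transmutation]

/-- The antipode of the image of `a` is the image of `S_R(a⁽¹⁾)` times `S(a⁽²⁾)`. -/
theorem antipode_incl (a : H) : HopfAlgebra.antipode k (incl π i j a) =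
    (LinearMap.mul' k B ∘ₗ TensorProduct.map (inclInv π i j).ofConv
      ((i : K →ₗ[k] B) ∘ₗ HopfAlgebra.antipode k)) (adCoaction π a) := by
  let T : H ⊗[k] (H ⊗[k] H) →ₗ[k] B := (LinearMap.mul' k B ∘ₗ TensorProduct.map
      (inclInv π i j).ofConv ((i : K →ₗ[k] B) ∘ₗ HopfAlgebra.antipode k)) ∘ₗ adKernel π
  have hT : ∀ a b c : H, T (a ⊗ₜ (b ⊗ₜ c)) =
      inclInv π i j b * homInv (base π i) c *
        base π i (HopfAlgebra.antipode k (HopfAlgebra.antipode k a)) := fun a b c => by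
    simp only [T, LinearMap.comp_apply, adKernel_tmul, TensorProduct.map_tmul,
      LinearMap.mul'_apply, ← map_antipode, HopfAlgebra.antipode_mul_antidistrib, map_mul,
      mul_assoc]
    simp
  -- Since S(S(a₁)a₃) = S(a₃)S²(a₁), the factor with a₃ meets `inclInv` at a₂, and together they
  -- leave j∘S.
  have e : inclInv π i j * homInv (base π i) = homInv (j : H →ₐ[k] B) := by
    rw [inclInv, mul_assoc, hom_mul_homInv, mul_one]
  trans T (comul₃ k H a)
  · rw [incl, (ℛ k a).convMul_apply, comul₃_eq_sum_sum, map_sum, map_sum]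
    refine Finset.sum_congr rfl fun l _ => ?_
    rw [HopfAlgebra.antipode_mul_antidistrib, map_sum]
    simp only [hT, ← Finset.sum_mul]
    rw [← (ℛ k ((ℛ k a).right l)).convMul_apply, e]
    simp [map_antipode]
  · rfl

theorem ExchangeRel.antipode_toBosonized (h : R.ExchangeRel π i j) (t : K ⊗[k] H) :
    HopfAlgebra.antipode k (toBosonized π i j t) =
      toBosonized π i j (((transmutation π R).bosonization R).antipode t) := by
  induction t using TensorProduct.induction_on with
  | zero => simp
  | add s t hs ht => simp only [map_add, hs, ht]
  | tmul x a =>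
    rw [toBosonized_tmul, HopfAlgebra.antipode_mul_antidistrib, antipode_incl]
    simp only [BraidedHopfData.bosonization, LinearMap.comp_apply, LinearMap.lTensor_tmul]
    change _ = toBosonized π i j ((transmutation π R).smashMul R (TensorProduct.map _ _
      ((TensorProduct.leftComm k K H K) (x ⊗ₜ adCoaction π a))))
    induction adCoaction π a using TensorProduct.induction_on with
    | zero => simp
    | add s t hs ht => simp only [map_add, TensorProduct.tmul_add, hs, ht, add_mul]
    | tmul b y =>
      have := h.toBosonized_mul (1 ⊗ₜ (transmutation π R).antipode b)
        (HopfAlgebra.antipode k (x * y) ⊗ₜ (transmutation π R).one)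
      simp only [TensorProduct.leftComm_tmul, TensorProduct.map_tmul]
      refine Eq.trans ?_ this.symm
      change _ = (i 1 * incl π i j ((transmutation π R).antipode b)) *
        (i (HopfAlgebra.antipode k (x * y)) * incl π i j 1)
      simp [h.incl_transmutation_antipode, HopfAlgebra.antipode_mul_antidistrib, mul_assoc,
        ← map_antipode]

end Coquasitriangular

/-! ### Transport of the Hopf algebra axioms -/

namespace HopfData

/-- The Hopf algebra axioms are transported along a linear isomorphism that preserves the structure
maps. -/
theorem isHopf_of_equiv {k V B : Type*} [CommRing k] [AddCommGroup V] [Module k V] [Ring B]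
    [HopfAlgebra k B] (D : HopfData k V) (φ : V ≃ₗ[k] B)
    (map_mul : ∀ x y, φ (D.mul (x ⊗ₜ y)) = φ x * φ y) (map_one : φ D.one = 1)
    (comul_map : ∀ x, Coalgebra.comul (R := k) (φ x) =
      TensorProduct.map (φ : V →ₗ[k] B) (φ : V →ₗ[k] B) (D.comul x))
    (counit_map : ∀ x, Coalgebra.counit (R := k) (φ x) = D.counit x)
    (antipode_map : ∀ x, HopfAlgebra.antipode k (φ x) = φ (D.antipode x)) : D.IsHopf := by
  have inj₂ : Function.Injective (TensorProduct.map (φ : V →ₗ[k] B) (φ : V →ₗ[k] B)) :=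
    (TensorProduct.congr φ φ).injective
  have hmul : ∀ t : V ⊗[k] V, φ (D.mul t) = LinearMap.mul' k B
      (TensorProduct.map (φ : V →ₗ[k] B) (φ : V →ₗ[k] B) t) := fun t =>
    LinearMap.congr_fun (TensorProduct.ext' (g := φ.toLinearMap ∘ₗ D.mul)
      (h := LinearMap.mul' k B ∘ₗ TensorProduct.map (φ : V →ₗ[k] B) (φ : V →ₗ[k] B)) map_mul) t
  have hcounit : Coalgebra.counit (R := k) ∘ₗ (φ : V →ₗ[k] B) = D.counit := LinearMap.ext counit_map
  have hcomul : Coalgebra.comul (R := k) ∘ₗ (φ : V →ₗ[k] B) = TensorProduct.map (φ : V →ₗ[k] B)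
    (φ : V →ₗ[k] B) ∘ₗ D.comul := LinearMap.ext comul_map
  have hantipode : HopfAlgebra.antipode k ∘ₗ (φ : V →ₗ[k] B) = (φ : V →ₗ[k] B) ∘ₗ D.antipode :=
    LinearMap.ext antipode_map
  refine
    { mul_assoc := fun a b c => φ.injective (by simp only [map_mul, mul_assoc])
      one_mul := fun a => φ.injective (by rw [map_mul, map_one, _root_.one_mul])
      mul_one := fun a => φ.injective (by rw [map_mul, map_one, _root_.mul_one])
      coassoc := fun a => ?_
      counit_comul := fun a => ?_
      comul_counit := fun a => ?_
      comul_mul := fun a b => inj₂ ?_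
      comul_one := inj₂ ?_
      counit_mul := fun a b => ?_
      counit_one := ?_
      antipode_left := fun a => φ.injective ?_
      antipode_right := fun a => φ.injective ?_ }
  · have inj₃ : Function.Injective (TensorProduct.map (φ : V →ₗ[k] B)
        (TensorProduct.map (φ : V →ₗ[k] B) (φ : V →ₗ[k] B))) :=
      (TensorProduct.congr φ (TensorProduct.congr φ φ)).injective
    refine inj₃ ?_
    have h := coassoc_apply (R := k) (φ a)
    rw [comul_map, ← LinearMap.comp_apply (LinearMap.rTensor _ _), LinearMap.rTensor_comp_map,
      ← LinearMap.comp_apply (LinearMap.lTensor _ _), LinearMap.lTensor_comp_map, hcomul] at h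
    refine Eq.trans ?_ (h.trans ?_)
    · generalize D.comul a = t
      induction t using TensorProduct.induction_on with
      | zero => simp
      | add s t hs ht => simp only [map_add, hs, ht]
      | tmul x y =>
        simp only [LinearMap.rTensor_tmul, TensorProduct.map_tmul, LinearMap.comp_apply]
        generalize D.comul x = u
        induction u using TensorProduct.induction_on with
        | zero => simp
        | add s t hs ht => simp only [map_add, TensorProduct.add_tmul, hs, ht]
        | tmul x y => simp
    · rw [← LinearMap.comp_apply (TensorProduct.map _ _) (LinearMap.lTensor _ _),
        LinearMap.map_comp_lTensor]
  · have h := rTensor_counit_comul (R := k) (φ a)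
    rw [comul_map, ← LinearMap.comp_apply, LinearMap.rTensor_comp_map, hcounit] at h
    refine (LinearEquiv.lTensor k φ).injective ?_
    refine Eq.trans ?_ (h.trans ?_)
    · change (φ : V →ₗ[k] B).lTensor k _ = _
      rw [← LinearMap.comp_apply, LinearMap.lTensor_comp_rTensor]
    · rfl
  · have h := lTensor_counit_comul (R := k) (φ a)
    rw [comul_map, ← LinearMap.comp_apply, LinearMap.lTensor_comp_map, hcounit] at h
    refine (LinearEquiv.rTensor k φ).injective ?_
    refine Eq.trans ?_ (h.trans ?_)
    · change (φ : V →ₗ[k] B).rTensor k _ = _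
      rw [← LinearMap.comp_apply, LinearMap.rTensor_comp_lTensor]
    · rfl
  · rw [← comul_map, map_mul, Bialgebra.comul_mul, comul_map, comul_map, crossedMul_comm_eq]
    generalize D.comul a = s
    generalize D.comul b = t
    induction s using TensorProduct.induction_on with
    | zero => simp
    | add s s' hs hs' => simp only [map_add, add_mul, TensorProduct.add_tmul, hs, hs']
    | tmul x y =>
      induction t using TensorProduct.induction_on with
      | zero => simp
      | add s s' hs hs' => simp only [map_add, mul_add, TensorProduct.tmul_add, hs, hs']
      | tmul z w => simp [map_mul]
  · rw [← comul_map, map_one, Bialgebra.comul_one]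
    simp [map_one, Algebra.TensorProduct.one_def]
  · rw [← counit_map, map_mul, Bialgebra.counit_mul, counit_map, counit_map]
  · rw [← counit_map, map_one, Bialgebra.counit_one]
  · rw [hmul, map_smul, map_one, ← counit_map, ← LinearMap.comp_apply (TensorProduct.map _ _),
      LinearMap.map_comp_rTensor, ← hantipode, ← LinearMap.rTensor_comp_map,
      LinearMap.comp_apply, ← comul_map, HopfAlgebra.mul_antipode_rTensor_comul_apply,
      Algebra.algebraMap_eq_smul_one]
  · rw [hmul, map_smul, map_one, ← counit_map, ← LinearMap.comp_apply (TensorProduct.map _ _),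
      LinearMap.map_comp_lTensor, ← hantipode, ← LinearMap.lTensor_comp_map,
      LinearMap.comp_apply, ← comul_map, HopfAlgebra.mul_antipode_lTensor_comul_apply,
      Algebra.algebraMap_eq_smul_one]

end HopfData

/-! ### Shear maps and their inverses -/

section Shear

variable {k K H : Type*} [CommRing k] [Ring K] [Algebra k K] [AddCommGroup H] [Module k H]
  [Coalgebra k H]

/-- `x ⊗ h ↦ x f(h₍₁₎) ⊗ h₍₂₎` -/
def shear (f : WithConv (H →ₗ[k] K)) : K ⊗[k] H →ₗ[k] K ⊗[k] H :=
  (LinearMap.mul' k K).rTensor H ∘ₗ (TensorProduct.assoc k K K H).symm.toLinearMap ∘ₗ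
    ((f.ofConv).rTensor H ∘ₗ comul).lTensor K

theorem shear_tmul (f : WithConv (H →ₗ[k] K)) (x : K) (h : H) : shear f (x ⊗ₜ h) =
    TensorProduct.map (LinearMap.mulLeft k x ∘ₗ f.ofConv) LinearMap.id (comul (R := k) h) := by
  simp only [shear, LinearMap.comp_apply, LinearMap.lTensor_tmul]
  induction comul (R := k) h using TensorProduct.induction_on with
  | zero => simp
  | add s t hs ht => simp only [map_add, TensorProduct.tmul_add, LinearEquiv.coe_coe] at hs ht ⊢; rw [hs, ht]
  | tmul a b => simp

theorem shear_one : shear (1 : WithConv (H →ₗ[k] K)) = LinearMap.id := by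
  refine TensorProduct.ext' fun x h => ?_
  rw [shear_tmul]
  conv_lhs => rw [← (ℛ k h).eq]
  simp only [map_sum, TensorProduct.map_tmul, LinearMap.comp_apply, LinearMap.id_apply]
  refine Eq.trans ?_ (sum_counit_smul_map (ℛ k h) (TensorProduct.mk k K H x))
  refine Finset.sum_congr rfl fun l _ => ?_
  change (x * algebraMap k K _) ⊗ₜ _ = _
  rw [← Algebra.commutes, ← Algebra.smul_def, TensorProduct.mk_apply, TensorProduct.smul_tmul']

/-- By coassociativity shearing is an antihomomorphism from the convolution ring to endomorphisms,
so a convolution inverse of f gives the inverse map. -/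
theorem shear_shear (f g : WithConv (H →ₗ[k] K)) (t : K ⊗[k] H) :
    shear f (shear g t) = shear (g * f) t := by
  induction t using TensorProduct.induction_on with
  | zero => simp
  | add s t hs ht => simp only [map_add, hs, ht]
  | tmul x h =>
    let T : H ⊗[k] (H ⊗[k] H) →ₗ[k] K ⊗[k] H :=
      TensorProduct.map (LinearMap.mulLeft k x ∘ₗ LinearMap.mul' k K ∘ₗ
        TensorProduct.map g.ofConv f.ofConv) LinearMap.id ∘ₗ
        (TensorProduct.assoc k H H H).symm.toLinearMap
    have hT : ∀ a b c : H, T (a ⊗ₜ (b ⊗ₜ c)) = (x * (g a * f b)) ⊗ₜ c := fun a b c => by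
      simp [T]
    trans T (comul₃ k H h)
    · rw [shear_tmul, comul₃_eq_sum_sum]
      conv_lhs => rw [← (ℛ k h).eq]
      simp only [map_sum, hT, TensorProduct.map_tmul, shear_tmul]
      refine Finset.sum_congr rfl fun l _ => ?_
      rw [LinearMap.id_apply]
      conv_lhs => rw [← (ℛ k ((ℛ k h).right l)).eq]
      simp
    · rw [shear_tmul, comul₃_eq_sum_sum_left]
      conv_rhs => rw [← (ℛ k h).eq]
      simp only [map_sum, hT, TensorProduct.map_tmul]
      refine Finset.sum_congr rfl fun l _ => ?_
      change _ = (x * (g * f) ((ℛ k h).left l)) ⊗ₜ _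
      rw [(ℛ k ((ℛ k h).left l)).convMul_apply, Finset.mul_sum, TensorProduct.sum_tmul]
      rfl

/-- `shear` for a convolution invertible map -/
def shearEquiv (f g : WithConv (H →ₗ[k] K)) (hfg : f * g = 1) (hgf : g * f = 1) :
    K ⊗[k] H ≃ₗ[k] K ⊗[k] H :=
  LinearEquiv.ofLinearMap (shear f) (shear g)
    (LinearMap.ext fun t => by rw [LinearMap.comp_apply, shear_shear, hgf, shear_one])
    (LinearMap.ext fun t => by rw [LinearMap.comp_apply, shear_shear, hfg, shear_one])

end Shear

/-! ### The adjoint coaction -/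

namespace Coquasitriangular

variable {k K H : Type*} [CommRing k] [Ring K] [HopfAlgebra k K] [Ring H] [HopfAlgebra k H]

section Coaction

variable (π : H →ₐc[k] K)

theorem adCoaction_eq : toConv (adCoaction π) =
    push (Algebra.TensorProduct.includeRight : K →ₐ[k] H ⊗[k] K) (homInv (π : H →ₐ[k] K)) *
      push (Algebra.TensorProduct.includeLeft : H →ₐ[k] H ⊗[k] K) (hom (AlgHom.id k H)) *
      push (Algebra.TensorProduct.includeRight : K →ₐ[k] H ⊗[k] K) (hom (π : H →ₐ[k] K)) := by
  refine Eq.trans ?_ (map_adCoaction (hom (AlgHom.id k H)) (AlgHom.id k K))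
  exact congrArg toConv (((congrArg (· ∘ₗ adCoaction π) TensorProduct.map_id).trans
    (LinearMap.id_comp _)).symm)

theorem lTensor_counit_adCoaction (a : H) :
    (counit (R := k) (A := K)).lTensor H (adCoaction π a) = a ⊗ₜ 1 := by
  have h := map_adCoaction (π := π) (hom (AlgHom.id k H)) (Bialgebra.counitAlgHom k K)
  have e₁ : homInv ((Bialgebra.counitAlgHom k K).comp (π : H →ₐ[k] K)) = 1 :=
    ext_apply fun x => by simp
  have e₂ : hom ((Bialgebra.counitAlgHom k K).comp (π : H →ₐ[k] K)) = 1 :=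
    ext_apply fun x => by simp
  rw [e₁, e₂, map_one, one_mul, mul_one] at h
  exact congrArg (fun F : WithConv (H →ₗ[k] H ⊗[k] k) => F a) h

theorem rTensor_counit_adCoaction (a : H) :
    (counit (R := k) (A := H)).rTensor K (adCoaction π a) = counit (R := k) a ⊗ₜ 1 := by
  have h := map_adCoaction (π := π) (hom (Bialgebra.counitAlgHom k H)) (AlgHom.id k K)
  have e : hom (Bialgebra.counitAlgHom k H) = 1 := ext_apply fun x => by simp
  rw [e, map_one, mul_one, ← map_mul, homInv_mul_hom, map_one] at h
  refine (congrArg (fun F : WithConv (H →ₗ[k] k ⊗[k] K) => F a) h).trans ?_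
  simp [Algebra.algebraMap_eq_smul_one, Algebra.TensorProduct.one_def, TensorProduct.smul_tmul']

theorem adCoaction_one : adCoaction π 1 = 1 ⊗ₜ 1 := by
  have h : comul₃ k H 1 = 1 ⊗ₜ (1 ⊗ₜ 1) := by
    simp [comul₃, Algebra.TensorProduct.one_def]
  rw [adCoaction, LinearMap.comp_apply, h, adKernel_tmul]
  simp

theorem hom_comp_comul_eq {A : Type*} [Ring A] [Algebra k A] (f : K ⊗[k] K →ₐ[k] A) :
    hom ((f.comp (Bialgebra.comulAlgHom k K)).comp (π : H →ₐ[k] K)) =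
      push (f.comp Algebra.TensorProduct.includeLeft) (hom (π : H →ₐ[k] K)) *
        push (f.comp Algebra.TensorProduct.includeRight) (hom (π : H →ₐ[k] K)) := by
  have h := congrArg (pull (π : H →ₗc[k] K)) (hom_comp_comul (f.comp
    Algebra.TensorProduct.includeLeft) (f.comp Algebra.TensorProduct.includeRight) f
    (fun x y => by simp [← map_mul]))
  rw [map_mul] at h
  exact h

theorem homInv_comp_comul_eq {A : Type*} [Ring A] [Algebra k A] (f : K ⊗[k] K →ₐ[k] A) :
    homInv ((f.comp (Bialgebra.comulAlgHom k K)).comp (π : H →ₐ[k] K)) =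
      push (f.comp Algebra.TensorProduct.includeRight) (homInv (π : H →ₐ[k] K)) *
        push (f.comp Algebra.TensorProduct.includeLeft) (homInv (π : H →ₐ[k] K)) := by
  refine left_inv_eq_right_inv (homInv_mul_hom _) ?_
  rw [hom_comp_comul_eq, mul_assoc, ← mul_assoc (push (f.comp
    Algebra.TensorProduct.includeRight) (hom (π : H →ₐ[k] K))), ← map_mul, hom_mul_homInv, map_one,
    one_mul, ← map_mul, hom_mul_homInv, map_one]

/-- The adjoint coaction is coassociative. -/
theorem adCoaction_isRightCoaction : IsRightCoaction (adCoaction π) where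
  counit := lTensor_counit_adCoaction π
  coassoc a := by
    have h₁ := congrArg (push (Algebra.TensorProduct.assoc k k k H K K).toAlgHom)
      (map_adCoaction (π := π) (toConv (adCoaction π)) (AlgHom.id k K))
    have h₂ := map_adCoaction (π := π) (hom (AlgHom.id k H)) (Bialgebra.comulAlgHom k K)
    have e₁ := hom_comp_comul_eq π (AlgHom.id k (K ⊗[k] K))
    have e₂ := homInv_comp_comul_eq π (AlgHom.id k (K ⊗[k] K))
    rw [AlgHom.id_comp] at e₁ e₂
    rw [e₁, e₂] at h₂
    conv_rhs at h₁ => rw [adCoaction_eq]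
    simp only [map_mul, ← mul_assoc] at h₁ h₂
    refine (congrArg (fun F : WithConv (H →ₗ[k] H ⊗[k] (K ⊗[k] K)) => F a)
      (h₁.trans (Eq.trans ?_ h₂.symm)))
    -- Both sides are the same product of five factors: π∘S in the third and then the second leg,
    -- the identity in the first, π in the second and then the third.
    refine congrArg₂ (· * ·) (congrArg₂ (· * ·) (congrArg₂ (· * ·) (congrArg₂ (· * ·) ?_ ?_) ?_)
      ?_) ?_ <;> exact ext_apply fun x => by simp [Algebra.TensorProduct.one_def]

/-- The diagonal coaction multiplies two conjugates, and the factor π that ends the first cancels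
the factor π∘S that begins the second. -/
theorem tensorCoaction_comul (a : H) :
    tensorCoaction (adCoaction π) (adCoaction π) (comul (R := k) a) =
      (comul (R := k) (A := H)).rTensor K (adCoaction π a) := by
  let m₁ : H ⊗[k] K →ₐ[k] (H ⊗[k] H) ⊗[k] K :=
    Algebra.TensorProduct.map Algebra.TensorProduct.includeLeft (AlgHom.id k K)
  let m₂ : H ⊗[k] K →ₐ[k] (H ⊗[k] H) ⊗[k] K :=
    Algebra.TensorProduct.map Algebra.TensorProduct.includeRight (AlgHom.id k K)
  have h₁ : toConv (tensorCoaction (adCoaction π) (adCoaction π) ∘ₗ comul) =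
      push m₁ (toConv (adCoaction π)) * push m₂ (toConv (adCoaction π)) := by
    refine ext_apply fun a => ?_
    rw [(ℛ k a).convMul_apply]
    refine (congrArg (tensorCoaction _ _) (ℛ k a).eq.symm).trans ?_
    rw [map_sum]
    refine Finset.sum_congr rfl fun l _ => ?_
    simp only [tensorCoaction, LinearMap.comp_apply, TensorProduct.map_tmul, push_apply]
    generalize adCoaction π ((ℛ k a).left l) = s
    generalize adCoaction π ((ℛ k a).right l) = t
    induction s using TensorProduct.induction_on with
    | zero => simp
    | add s s' hs hs' => simp only [map_add, add_mul, TensorProduct.add_tmul, hs, hs']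
    | tmul x y =>
      induction t using TensorProduct.induction_on with
      | zero => simp
      | add s s' hs hs' => simp only [map_add, mul_add, TensorProduct.tmul_add, hs, hs']
      | tmul z w => simp [m₁, m₂]
  have h₂ := map_adCoaction (π := π) (hom (Bialgebra.comulAlgHom k H)) (AlgHom.id k K)
  have h₃ : hom (Bialgebra.comulAlgHom k H) = hom Algebra.TensorProduct.includeLeft *
      hom Algebra.TensorProduct.includeRight :=
    hom_comp_comul _ _ (AlgHom.id k (H ⊗[k] H)) (by simp)
  have e : (push (Algebra.TensorProduct.includeRight : K →ₐ[k] (H ⊗[k] H) ⊗[k] K))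
      (hom (π : H →ₐ[k] K)) * push Algebra.TensorProduct.includeRight (homInv (π : H →ₐ[k] K)) =
      1 := by rw [← map_mul, hom_mul_homInv, map_one]
  have hm₁ : m₁.comp Algebra.TensorProduct.includeRight =
    Algebra.TensorProduct.includeRight := by ext; simp [m₁, Algebra.TensorProduct.one_def]
  have hm₂ : m₂.comp Algebra.TensorProduct.includeRight =
    Algebra.TensorProduct.includeRight := by ext; simp [m₂, Algebra.TensorProduct.one_def]
  have p₁ : ∀ x : WithConv (H →ₗ[k] K), push m₁ (push Algebra.TensorProduct.includeRight x) =
    push Algebra.TensorProduct.includeRight x := fun x => congrArg (fun f => push f x) hm₁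
  have p₂ : ∀ x : WithConv (H →ₗ[k] K), push m₂ (push Algebra.TensorProduct.includeRight x) =
    push Algebra.TensorProduct.includeRight x := fun x => congrArg (fun f => push f x) hm₂
  refine congrArg (fun F : WithConv (H →ₗ[k] (H ⊗[k] H) ⊗[k] K) => F a)
    (h₁.trans (Eq.trans ?_ h₂.symm))
  rw [h₃, adCoaction_eq]
  simp only [map_mul, p₁, p₂, mul_assoc, AlgHom.id_comp]
  rw [← mul_assoc (push _ (hom (π : H →ₐ[k] K))), e, one_mul]
  rfl

end Coaction
end Coquasitriangular

/-! ### The braided Hopf algebra axioms for H_R, read off through projections of B -/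

namespace Coquasitriangular

variable {k K H : Type*} [CommRing k] [Ring K] [HopfAlgebra k K] [Ring H] [HopfAlgebra k H]

theorem braiding_eq_lTensor {M N : Type*} [AddCommGroup M] [Module k M] [AddCommGroup N]
    [Module k N] (R : Coquasitriangular k K) (δM : M →ₗ[k] M ⊗[k] K) (δN : N →ₗ[k] N ⊗[k] K)
    (m : M) (n : N) :
    R.braiding δM δN (m ⊗ₜ n) = ((R.contract M).flip (δM m)).lTensor N (δN n) := by
  obtain ⟨s, h⟩ := TensorProduct.exists_finset (δN n)
  rw [R.braiding_eq_sum δM δN m s Prod.fst Prod.snd h, h, map_sum]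
  rfl

variable {R : Coquasitriangular k K} {π : H →ₐc[k] K}
  {B : Type*} [Ring B] [HopfAlgebra k B] {i : K →ₐc[k] B} {j : H →ₐc[k] B}

/-- `(b ⊗ z) ⊗ c ↦ ι(b) ⊗ i(z) ι(c)`, where `ι` is `incl`. -/
def cosmashIncl (π : H →ₐc[k] K) (i : K →ₐc[k] B) (j : H →ₐc[k] B) :
    (H ⊗[k] K) ⊗[k] H →ₗ[k] B ⊗[k] B :=
  LinearMap.mul' k (B ⊗[k] B) ∘ₗ TensorProduct.map
      (TensorProduct.map (incl π i j).ofConv (i : K →ₐ[k] B).toLinearMap)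
      (Algebra.TensorProduct.includeRight.toLinearMap ∘ₗ (incl π i j).ofConv)

@[simp] theorem cosmashIncl_tmul (b c : H) (z : K) : cosmashIncl π i j ((b ⊗ₜ z) ⊗ₜ c) =
    incl π i j b ⊗ₜ (i z * incl π i j c) := by
  simp [cosmashIncl]

/-- The second leg carries j(S(x₁)) iπ(x₃), which the projection to K will turn into π(S(x₁)x₃), the
second leg of the adjoint coaction. -/
theorem comul_inclInv (x : H) : comul (R := k) (inclInv π i j x) =
    triple (push Algebra.TensorProduct.includeRight (homInv (j : H →ₐ[k] B)))
      (push Algebra.TensorProduct.includeLeft (inclInv π i j))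
      (push Algebra.TensorProduct.includeRight (hom (base π i))) (comul₃ k H x) := by
  let iL : B →ₐ[k] B ⊗[k] B := Algebra.TensorProduct.includeLeft
  let iR : B →ₐ[k] B ⊗[k] B := Algebra.TensorProduct.includeRight
  have hj : push (Bialgebra.comulAlgHom k B) (homInv (j : H →ₐ[k] B)) =
      push iR (homInv (j : H →ₐ[k] B)) * push iL (homInv (j : H →ₐ[k] B)) := by
    refine Eq.trans ?_ (homInv_comp_comul (iL.comp (j : H →ₐ[k] B)) (iR.comp (j : H →ₐ[k] B))
      (Algebra.TensorProduct.map (j : H →ₐ[k] B) (j : H →ₐ[k] B)) (by simp [iL, iR]))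
    refine ext_apply fun x => ?_
    exact (CoalgHomClass.map_comp_comul_apply (R := k) j (HopfAlgebra.antipode k x)).symm
  have hp : push (Bialgebra.comulAlgHom k B) (hom (base π i)) =
      push iL (hom (base π i)) * push iR (hom (base π i)) := by
    rw [incl_mul_incl]
    refine ext_apply fun x => ?_
    exact (CoalgHomClass.map_comp_comul_apply (R := k) (i.comp π) x).symm
  have key : push (Bialgebra.comulAlgHom k B) (inclInv π i j) =
      push iR (homInv (j : H →ₐ[k] B)) * push iL (inclInv π i j) *
        push iR (hom (base π i)) := by
    rw [inclInv, map_mul, hj, hp, map_mul]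
    simp only [mul_assoc]
  rw [← mul_mul_apply]
  exact congrArg (fun F : WithConv (H →ₗ[k] B ⊗[k] B) => F x) key

section Projections

variable {P : B →ₗ[k] H} {p : B →ₗ[k] K}

theorem ExchangeRel.counit_transmutation_mul (h : R.ExchangeRel π i j) (a b : H) :
    counit (R := k) ((transmutation π R).mul (a ⊗ₜ b)) =
      counit (R := k) a * counit (R := k) b := by
  rw [← counit_incl (π := π) (i := i) (j := j), h.incl_transmutation_mul, Bialgebra.counit_mul,
    counit_incl, counit_incl]

theorem ExchangeRel.incl_mul_mul (h : R.ExchangeRel π i j) (x z : K) (a b : H) :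
    i x * incl π i j a * (i z * incl π i j b) = ∑ l ∈ (ℛ k z).index, i (x * (ℛ k z).left l) *
      incl π i j ((transmutation π R).mul
        (R.contract H ((ℛ k z).right l) (adCoaction π a) ⊗ₜ b)) := by
  rw [mul_assoc, ← mul_assoc (incl π i j a), h.incl_mul_apply a (ℛ k z), Finset.sum_mul,
    Finset.mul_sum]
  simp only [h.incl_transmutation_mul, map_mul, mul_assoc]

/-- P is not multiplicative: the factor from K that stands between a and b survives as a contraction
with R. This is where the braiding comes from. -/
theorem ExchangeRel.proj_mul (h : R.ExchangeRel π i j) (hP : ∀ x a, P (i x * incl π i j a) = counit (R := k) x • a)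
    (x z : K) (a b : H) :
    P (i x * incl π i j a * (i z * incl π i j b)) =
      counit (R := k) x • (transmutation π R).mul (R.contract H z (adCoaction π a) ⊗ₜ b) := by
  rw [h.incl_mul_mul, map_sum]
  simp only [hP, Bialgebra.counit_mul, mul_smul]
  rw [← Finset.smul_sum]
  congr 1
  exact sum_counit_smul_map (ℛ k z) ((transmutation π R).mul ∘ₗ (TensorProduct.mk k H H).flip b ∘ₗ
    (R.contract H).flip (adCoaction π a))

theorem ExchangeRel.proj_mul' (h : R.ExchangeRel π i j) (hp : ∀ x a, p (i x * incl π i j a) = counit (R := k) a • x)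
    (x z : K) (a b : H) :
    p (i x * incl π i j a * (i z * incl π i j b)) =
      (counit (R := k) a * counit (R := k) b) • (x * z) := by
  rw [h.incl_mul_mul, map_sum]
  have e : ∀ w, counit (R := k) (R.contract H w (adCoaction π a)) =
      counit (R := k) w * counit (R := k) a := fun w => by
    rw [R.map_contract, rTensor_counit_adCoaction, contract_tmul, form_one_left, smul_eq_mul]
  simp only [hp, h.counit_transmutation_mul, e]
  refine Eq.trans ?_ (congrArg (_ • ·) (sum_map_counit_smul (ℛ k z) (LinearMap.mulLeft k x)))
  rw [Finset.smul_sum]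
  refine Finset.sum_congr rfl fun l _ => ?_
  rw [smul_smul, LinearMap.mulLeft_apply]
  congr 1
  ring

theorem ExchangeRel.proj_right_mul (h : R.ExchangeRel π i j) (hp : ∀ x a, p (i x * incl π i j a) = counit (R := k) a • x)
    (a : H) (w : K) : p (j a * i w) = π a * w := by
  have e : j a = ∑ l ∈ (ℛ k a).index, base π i ((ℛ k a).left l) *
      incl π i j ((ℛ k a).right l) := by
    have := congrArg (fun F : WithConv (H →ₗ[k] B) => F a) (base_mul_incl (π := π) (i := i)
      (j := j))
    simp only [(ℛ k a).convMul_apply] at this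
    exact this.symm
  rw [e, Finset.sum_mul, map_sum]
  refine Eq.trans ?_ (sum_map_counit_smul (ℛ k a) (LinearMap.mulRight k w ∘ₗ (π : H →ₗ[k] K)))
  refine Finset.sum_congr rfl fun l _ => ?_
  have := h.proj_mul' hp (π ((ℛ k a).left l)) w ((ℛ k a).right l) 1
  rw [incl_one, mul_one, Bialgebra.counit_one, mul_one] at this
  exact this

theorem proj_incl (hP : ∀ x a, P (i x * incl π i j a) = counit (R := k) x • a) (a : H) :
    P (incl π i j a) = a := by
  have := hP 1 a
  rwa [map_one, one_mul, Bialgebra.counit_one, one_smul] at this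

theorem rid_counit_adCoaction (a : H) : TensorProduct.rid k H
    ((counit (R := k) (A := K)).lTensor H (adCoaction π a)) = a := by
  simp [lTensor_counit_adCoaction]

theorem rid_counit_rTensor_adCoaction (a : H) : TensorProduct.rid k (H ⊗[k] K)
    ((counit (R := k) (A := H)).lTensor (H ⊗[k] K) ((adCoaction π).rTensor H (comul a))) =
      adCoaction π a := by
  rw [← LinearMap.comp_apply (LinearMap.lTensor _ _), LinearMap.lTensor_comp_rTensor,
    ← LinearMap.rTensor_comp_lTensor, LinearMap.comp_apply, lTensor_counit_comul]
  simp

/-- The coaction is (P ⊗ p)Δι, and Δ(ι(x)ι(y)) = Δι(x)Δι(y). On the elements that occur, P is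
multiplicative in the first leg (no factor from K is present) and p is multiplicative in the second,
up to counits. -/
theorem ExchangeRel.coact_transmutation_mul (h : R.ExchangeRel π i j)
    (hP : ∀ x a, P (i x * incl π i j a) = counit (R := k) x • a)
    (hp : ∀ x a, p (i x * incl π i j a) = counit (R := k) a • x) (x y : H) :
    adCoaction π ((transmutation π R).mul (x ⊗ₜ y)) = (transmutation π R).mul.rTensor K
      (tensorCoaction (adCoaction π) (adCoaction π) (x ⊗ₜ y)) := by
  let L := cosmashIncl π i j
  let Q : (H ⊗[k] K) ⊗[k] H →ₗ[k] H ⊗[k] K := (TensorProduct.rid k (H ⊗[k] K)).toLinearMap ∘ₗ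
    (counit (R := k) (A := H)).lTensor (H ⊗[k] K)
  let M : (H ⊗[k] K) ⊗[k] (H ⊗[k] K) →ₗ[k] H ⊗[k] K :=
    (transmutation π R).mul.rTensor K ∘ₗ (LinearMap.mul' k K).lTensor (H ⊗[k] H) ∘ₗ
      (TensorProduct.tensorTensorTensorComm k H K H K).toLinearMap
  have hQ : ∀ a, Q ((adCoaction π).rTensor H (comul a)) = adCoaction π a :=
    rid_counit_rTensor_adCoaction
  have e₁ : TensorProduct.map P p ∘ₗ L = Q :=
    TensorProduct.ext_threefold fun b z c => by
      have := hp z c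
      simp [L, Q, proj_incl hP, this, TensorProduct.tmul_smul]
  have e₂ : TensorProduct.map P p ∘ₗ LinearMap.mul' k (B ⊗[k] B) ∘ₗ TensorProduct.map L L =
      M ∘ₗ TensorProduct.map Q Q := by
    refine TensorProduct.ext (TensorProduct.ext_threefold fun b z c =>
      TensorProduct.ext_threefold fun b' z' c' => ?_)
    have := h.proj_mul' hp z z' c c'
    have hb := (congrArg P (h.incl_transmutation_mul b b')).symm.trans (proj_incl hP _)
    simp [L, M, Q, this, hb, TensorProduct.tmul_smul, TensorProduct.smul_tmul', smul_smul,
      mul_comm]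
    rw [← map_smul (transmutation π R).mul, TensorProduct.smul_tmul']
  have e₃ : ∀ a, comul (R := k) (incl π i j a) = L ((adCoaction π).rTensor H (comul a)) :=
    comul_incl
  trans TensorProduct.map P p (comul (R := k) (incl π i j x * incl π i j y))
  · rw [← h.incl_transmutation_mul, e₃, ← hQ, ← e₁]
    rfl
  · rw [Bialgebra.comul_mul, e₃, e₃]
    refine (LinearMap.congr_fun e₂ (_ ⊗ₜ _)).trans ?_
    rw [LinearMap.comp_apply, TensorProduct.map_tmul, hQ, hQ]
    rfl

/-- Both sides are (P ⊗ p)Δ applied to ι(S_R(x)), with Δ computed once by `comul_incl` and once by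
`comul_inclInv`. -/
theorem ExchangeRel.coact_transmutation_antipode (h : R.ExchangeRel π i j)
    (hP : ∀ x a, P (i x * incl π i j a) = counit (R := k) x • a)
    (hp : ∀ x a, p (i x * incl π i j a) = counit (R := k) a • x) (x : H) :
    adCoaction π ((transmutation π R).antipode x) =
      (transmutation π R).antipode.rTensor K (adCoaction π x) := by
  trans TensorProduct.map P p (comul (R := k) (inclInv π i j x))
  · rw [← h.incl_transmutation_antipode, comul_incl]
    refine (rid_counit_rTensor_adCoaction _).symm.trans ?_
    generalize (adCoaction π).rTensor H (comul ((transmutation π R).antipode x)) = t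
    refine LinearMap.congr_fun (f := (TensorProduct.rid k (H ⊗[k] K)).toLinearMap ∘ₗ
      (counit (R := k) (A := H)).lTensor (H ⊗[k] K))
      (g := TensorProduct.map P p ∘ₗ cosmashIncl π i j)
      (TensorProduct.ext_threefold fun b z c => ?_) t
    have := hp z c
    simp [proj_incl hP, this, TensorProduct.tmul_smul]
  · rw [comul_inclInv]
    refine LinearMap.congr_fun (f := TensorProduct.map P p ∘ₗ triple _ _ _)
      (g := (transmutation π R).antipode.rTensor K ∘ₗ adKernel π)
      (TensorProduct.ext_threefold' fun a b c => ?_) (comul₃ k H x)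
    rw [LinearMap.comp_apply, LinearMap.comp_apply, adKernel_tmul, LinearMap.rTensor_tmul,
      triple_tmul]
    have e₁ := (congrArg P (h.incl_transmutation_antipode b)).symm.trans (proj_incl hP _)
    have e₂ := h.proj_right_mul hp (HopfAlgebra.antipode k a) (π c)
    simp [e₁, e₂]

/-- Here (P ⊗ P)Δι is the coproduct of H. In Δι(x)Δι(y) the second leg contains ι(x₂) i(y₁⁽²⁾), and
`proj_mul` turns this crossing into the braiding of x₂ with y₁. -/
theorem ExchangeRel.comul_transmutation_mul (h : R.ExchangeRel π i j)
    (hP : ∀ x a, P (i x * incl π i j a) = counit (R := k) x • a) (x y : H) :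
    comul (R := k) ((transmutation π R).mul (x ⊗ₜ y)) =
      crossedMul (transmutation π R).mul (transmutation π R).mul
        (R.braiding (adCoaction π) (adCoaction π)) (comul x ⊗ₜ comul y) := by
  let L := cosmashIncl π i j
  let q : H ⊗[k] K →ₗ[k] H := (TensorProduct.rid k H).toLinearMap ∘ₗ
    (counit (R := k) (A := K)).lTensor H
  have hq : ∀ a, q (adCoaction π a) = a := rid_counit_adCoaction
  have e₃ : ∀ a, comul (R := k) (incl π i j a) = L ((adCoaction π).rTensor H (comul a)) :=
    comul_incl
  have e₁ : TensorProduct.map P P ∘ₗ L = q.rTensor H :=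
    TensorProduct.ext_threefold fun b z c => by
      have := hP z c
      simp [L, q, proj_incl hP, this, TensorProduct.tmul_smul, TensorProduct.smul_tmul']
  have e₂ : ∀ (u u' : H ⊗[k] K) (c c' : H),
      TensorProduct.map P P (L (u ⊗ₜ c) * L (u' ⊗ₜ c')) =
        TensorProduct.map ((transmutation π R).mul ∘ₗ TensorProduct.mk k H H (q u))
          ((transmutation π R).mul ∘ₗ (TensorProduct.mk k H H).flip c')
          (((R.contract H).flip (adCoaction π c)).lTensor H u') := fun u u' c c' => by
    induction u using TensorProduct.induction_on with
    | zero => simp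
    | add s t hs ht =>
      simp only [TensorProduct.add_tmul, map_add, add_mul, hs, ht, LinearMap.comp_add,
        TensorProduct.map_add_left, LinearMap.add_apply]
    | tmul b z =>
      induction u' using TensorProduct.induction_on with
      | zero => simp
      | add s t hs ht => simp only [TensorProduct.add_tmul, map_add, mul_add, hs, ht]
      | tmul b' z' =>
        have := h.proj_mul hP z z' c c'
        have hb := (congrArg P (h.incl_transmutation_mul b b')).symm.trans (proj_incl hP _)
        simp [L, q, this, hb, TensorProduct.tmul_smul, TensorProduct.smul_tmul']
        rw [← map_smul (transmutation π R).mul, TensorProduct.smul_tmul']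
  trans TensorProduct.map P P (comul (R := k) (incl π i j x * incl π i j y))
  · rw [← h.incl_transmutation_mul, e₃]
    refine Eq.trans ?_ (LinearMap.congr_fun e₁ _).symm
    rw [← LinearMap.comp_apply (LinearMap.rTensor _ _), ← LinearMap.rTensor_comp,
      show q ∘ₗ adCoaction π = LinearMap.id from LinearMap.ext hq, LinearMap.rTensor_id]
    rfl
  · rw [Bialgebra.comul_mul, e₃, e₃, ← (ℛ k x).eq, ← (ℛ k y).eq]
    simp only [map_sum, Finset.sum_mul_sum, LinearMap.rTensor_tmul, e₂, hq,
      TensorProduct.sum_tmul, TensorProduct.tmul_sum, crossedMul_tmul, braiding_eq_lTensor]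
    exact Finset.sum_comm

/-- P makes ι injective, so associativity, units and antipode are inherited from B; the antipode
axioms hold because ι∘S_R is the convolution inverse of ι. -/
theorem ExchangeRel.transmutation_isBraidedHopf (h : R.ExchangeRel π i j)
    (hP : ∀ x a, P (i x * incl π i j a) = counit (R := k) x • a)
    (hp : ∀ x a, p (i x * incl π i j a) = counit (R := k) a • x) :
    (transmutation π R).IsBraidedHopf R := by
  have inj : Function.Injective (incl π i j).ofConv :=
    Function.LeftInverse.injective (proj_incl hP)
  have hmul : ∀ a b, incl π i j ((transmutation π R).mul (a ⊗ₜ b)) =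
    incl π i j a * incl π i j b := h.incl_transmutation_mul
  have hmap : ∀ t, incl π i j ((transmutation π R).mul t) = LinearMap.mul' k B
      (TensorProduct.map (incl π i j).ofConv (incl π i j).ofConv t) := fun t =>
    LinearMap.congr_fun (TensorProduct.ext' (g := (incl π i j).ofConv ∘ₗ (transmutation π R).mul)
      (h := LinearMap.mul' k B ∘ₗ TensorProduct.map (incl π i j).ofConv (incl π i j).ofConv)
      hmul) t
  have hS : (incl π i j).ofConv ∘ₗ (transmutation π R).antipode = (inclInv π i j).ofConv :=
    LinearMap.ext h.incl_transmutation_antipode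
  have hone : ∀ a : H, (algebraMap k B) (counit (R := k) a) =
      incl π i j ((counit (R := k) a : k) • (1 : H)) := fun a => by
    rw [map_smul, incl_one, Algebra.algebraMap_eq_smul_one]
  refine
    { isRightCoaction := adCoaction_isRightCoaction π
      coact_mul := fun x => ?_
      coact_one := adCoaction_one π
      coact_comul := tensorCoaction_comul π
      coact_counit := rTensor_counit_adCoaction π
      coact_antipode := h.coact_transmutation_antipode hP hp
      isHopfFor :=
      { mul_assoc := fun a b c => inj ?_
        one_mul := fun a => inj ?_
        mul_one := fun a => inj ?_
        coassoc := coassoc_apply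
        counit_comul := rTensor_counit_comul
        comul_counit := lTensor_counit_comul
        comul_mul := h.comul_transmutation_mul hP
        comul_one := Bialgebra.comul_one
        counit_mul := h.counit_transmutation_mul
        counit_one := Bialgebra.counit_one
        antipode_left := fun a => inj ?_
        antipode_right := fun a => inj ?_ } }
  · exact LinearMap.congr_fun (TensorProduct.ext' (g := adCoaction π ∘ₗ (transmutation π R).mul)
      (h := (transmutation π R).mul.rTensor K ∘ₗ
        tensorCoaction (adCoaction π) (adCoaction π)) (h.coact_transmutation_mul hP hp)) x
  · simp only [hmul, mul_assoc]
  · exact (hmul _ _).trans ((congrArg (· * _) incl_one).trans (one_mul _))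
  · exact (hmul _ _).trans ((congrArg (_ * ·) incl_one).trans (mul_one _))
  · rw [hmap, ← LinearMap.comp_apply (TensorProduct.map _ _), LinearMap.map_comp_rTensor, hS]
    refine (congrArg (fun F : WithConv (H →ₗ[k] B) => F a) inclInv_mul_incl).trans (hone a)
  · rw [hmap, ← LinearMap.comp_apply (TensorProduct.map _ _), LinearMap.map_comp_lTensor, hS]
    refine (congrArg (fun F : WithConv (H →ₗ[k] B) => F a) incl_mul_inclInv).trans (hone a)

end Projections
end Coquasitriangular

/-- An isomorphism of modules that preserves the structure maps is an isomorphism of bialgebras. -/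
def HopfData.carrierEquiv {k V B : Type*} [CommRing k] [AddCommGroup V] [Module k V] [Ring B]
    [HopfAlgebra k B] (D : HopfData k V) (hD : D.IsHopf) (φ : V ≃ₗ[k] B)
    (map_mul : ∀ x y, φ (D.mul (x ⊗ₜ y)) = φ x * φ y)
    (comul_map : ∀ x, Coalgebra.comul (R := k) (φ x) =
      TensorProduct.map (φ : V →ₗ[k] B) (φ : V →ₗ[k] B) (D.comul x))
    (counit_map : ∀ x, Coalgebra.counit (R := k) (φ x) = D.counit x) :
    D.Carrier hD ≃ₐc[k] B where
  toFun := φ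
  map_add' := φ.map_add
  map_smul' := φ.map_smul
  invFun := φ.symm
  left_inv := φ.left_inv
  right_inv := φ.right_inv
  map_mul' := map_mul
  counit_comp := LinearMap.ext counit_map
  map_comp_comul := LinearMap.ext fun x => (comul_map x).symm

/-- An isomorphism of bialgebras preserves the antipode. -/
theorem BialgEquiv.map_antipode {k A B : Type*} [CommRing k] [Ring A] [HopfAlgebra k A] [Ring B]
    [HopfAlgebra k B] (e : A ≃ₐc[k] B) (a : A) :
    e (HopfAlgebra.antipode k a) = HopfAlgebra.antipode k (e a) :=
  _root_.map_antipode (e : A →ₐc[k] B) a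

/-! ### The Hopf algebra K ⋈_R H and the isomorphism -/

namespace Coquasitriangular

variable {k K H : Type*} [CommRing k] [Ring K] [HopfAlgebra k K] [Ring H] [HopfAlgebra k H]
  (R : Coquasitriangular k K) (π : H →ₐc[k] K)

/-- The Hopf algebra `K ⋈_R H`. -/
abbrev Bowtie : Type _ := (bowtie π R (R.bowtieAntipode π)).Carrier (R.bowtie_isHopf π)

/-- The identity map from `K ⊗ H` to `K ⋈_R H` -/
abbrev toBowtie : K ⊗[k] H ≃ₗ[k] R.Bowtie π :=
  (bowtie π R (R.bowtieAntipode π)).toCarrier (R.bowtie_isHopf π)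

theorem toBowtie_mul (x y : K ⊗[k] H) : R.toBowtie π x * R.toBowtie π y = R.toBowtie π
    (crossedMul (LinearMap.mul' k K) (LinearMap.mul' k H) (bowtieExchange π R) (x ⊗ₜ y)) := rfl

theorem toBowtie_mul_eq {x y z : K ⊗[k] H}
    (h : R.bowtieAct π z = R.bowtieAct π x * R.bowtieAct π y) :
    R.toBowtie π z = R.toBowtie π x * R.toBowtie π y := by
  rw [toBowtie_mul]
  exact congrArg _ (R.bowtieAct_injective π (h.trans (R.bowtieAct_mul π x y).symm))

theorem comul_toBowtie (x : K ⊗[k] H) : comul (R := k) (R.toBowtie π x) =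
    TensorProduct.map (R.toBowtie π : _ →ₗ[k] R.Bowtie π) (R.toBowtie π : _ →ₗ[k] R.Bowtie π)
      (comul (R := k) x) :=
  (LinearMap.congr_fun TensorProduct.map_id _).symm

theorem counit_toBowtie (x : K ⊗[k] H) :
    counit (R := k) (R.toBowtie π x) = counit (R := k) x := rfl

/-- The inclusion of `K` in `K ⋈_R H` -/
def bowtieLeft : K →ₐc[k] R.Bowtie π where
  toFun x := R.toBowtie π (x ⊗ₜ 1)
  map_add' x y := by rw [TensorProduct.add_tmul, map_add]
  map_smul' c x := by rw [← TensorProduct.smul_tmul', map_smul]; rfl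
  map_one' := rfl
  map_mul' x y := R.toBowtie_mul_eq π (by simp [bowtieAct_tmul])
  counit_comp := LinearMap.ext fun x => by
    change counit (R := k) (R.toBowtie π (x ⊗ₜ[k] (1 : H))) = _
    rw [counit_toBowtie]
    simp
  map_comp_comul := LinearMap.ext fun x => by
    change _ = comul (R := k) (R.toBowtie π (x ⊗ₜ[k] (1 : H)))
    rw [comul_toBowtie, TensorProduct.comul_tmul, LinearMap.comp_apply, ← (ℛ k x).eq]
    simp [Algebra.TensorProduct.one_def, TensorProduct.sum_tmul]

/-- The inclusion of `H` in `K ⋈_R H` -/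
def bowtieRight : H →ₐc[k] R.Bowtie π where
  toFun x := R.toBowtie π (1 ⊗ₜ x)
  map_add' x y := by rw [TensorProduct.tmul_add, map_add]
  map_smul' c x := by rw [TensorProduct.tmul_smul, map_smul]; rfl
  map_one' := rfl
  map_mul' x y := R.toBowtie_mul_eq π (by simp [bowtieAct_tmul])
  counit_comp := LinearMap.ext fun x => by
    change counit (R := k) (R.toBowtie π ((1 : K) ⊗ₜ[k] x)) = _
    rw [counit_toBowtie]
    simp
  map_comp_comul := LinearMap.ext fun x => by
    change _ = comul (R := k) (R.toBowtie π ((1 : K) ⊗ₜ[k] x))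
    rw [comul_toBowtie, TensorProduct.comul_tmul, LinearMap.comp_apply, ← (ℛ k x).eq]
    simp [Algebra.TensorProduct.one_def, TensorProduct.tmul_sum]

theorem bowtieLeft_mul_bowtieRight (x : K) (h : H) :
    R.bowtieLeft π x * R.bowtieRight π h = R.toBowtie π (x ⊗ₜ h) :=
  (R.toBowtie_mul_eq π (x := x ⊗ₜ 1) (y := 1 ⊗ₜ h) (by simp [bowtieAct_tmul])).symm

theorem bowtieRight_mul_bowtieLeft (h : H) (x : K) :
    R.bowtieRight π h * R.bowtieLeft π x = R.toBowtie π (bowtieExchange π R (h ⊗ₜ x)) :=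
  (R.toBowtie_mul_eq π (x := 1 ⊗ₜ h) (y := x ⊗ₜ 1)
    (by simp [bowtieAct_tmul, bowtieAct_exchange])).symm

theorem bowtie_exchangeRel : R.ExchangeRel π (R.bowtieLeft π) (R.bowtieRight π) := by
  let f : K ⊗[k] H →ₗ[k] R.Bowtie π := (R.toBowtie π).toLinearMap
  have e₁ : fst (hom (R.bowtieRight π : H →ₐ[k] R.Bowtie π)) *
      snd (hom (R.bowtieLeft π : K →ₐ[k] R.Bowtie π)) =
      toConv (f ∘ₗ bowtieExchange π R) := ext_tmul fun h x =>
    (fst_mul_snd_apply _ _ h x).trans (R.bowtieRight_mul_bowtieLeft π h x)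
  have e₂ : snd (hom (R.bowtieLeft π : K →ₐ[k] R.Bowtie π)) *
      fst (hom (R.bowtieRight π : H →ₐ[k] R.Bowtie π)) =
      toConv (f ∘ₗ (TensorProduct.comm k H K).toLinearMap) := ext_tmul fun h x =>
    (snd_mul_fst_apply _ _ h x).trans (R.bowtieLeft_mul_bowtieRight π x h)
  rw [ExchangeRel, e₁, e₂]
  exact (comp_mul_scalar f (R.form₁ π) (scalar _ (R.inv₁ π) *
      toConv (TensorProduct.comm k H K).toLinearMap)).trans
      (congrArg (· * _) (comp_scalar_mul f _ _))

/-- `x ⊗ h ↦ x π(S(h₍₁₎)) ⊗ h₍₂₎` as an isomorphism from `K # H_R` to `K ⋈_R H` -/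
def bosonizationEquiv : K ⊗[k] H ≃ₗ[k] R.Bowtie π :=
  (shearEquiv (homInv (π : H →ₐ[k] K)) (hom (π : H →ₐ[k] K)) (homInv_mul_hom _)
    (hom_mul_homInv _)).trans (R.toBowtie π)

/-- Joins the two descriptions of one map: as a shear it is bijective, as `toBosonized` it preserves
the structure. -/
theorem bosonizationEquiv_apply (t : K ⊗[k] H) : R.bosonizationEquiv π t =
    toBosonized π (R.bowtieLeft π) (R.bowtieRight π) t := by
  refine LinearMap.congr_fun (f := (R.bosonizationEquiv π).toLinearMap)
    (TensorProduct.ext' fun x h => ?_) t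
  change R.toBowtie π (shear (homInv (π : H →ₐ[k] K)) (x ⊗ₜ h)) = _
  rw [shear_tmul, toBosonized_tmul, incl, (ℛ k h).convMul_apply, Finset.mul_sum]
  conv_lhs => rw [← (ℛ k h).eq]
  simp only [map_sum, TensorProduct.map_tmul, LinearMap.comp_apply, LinearMap.id_apply,
    ← bowtieLeft_mul_bowtieRight]
  refine Finset.sum_congr rfl fun l _ => ?_
  rw [LinearMap.mulLeft_apply, map_mul, mul_assoc]
  rfl

theorem bosonizationEquiv_symm_toBowtie (x : K) (h : H) :
    (R.bosonizationEquiv π).symm (R.toBowtie π (x ⊗ₜ h)) =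
      TensorProduct.map (LinearMap.mulLeft k x ∘ₗ (π : H →ₗ[k] K)) LinearMap.id
        (comul (R := k) h) :=
  shear_tmul (hom (π : H →ₐ[k] K)) x h

/-- The transmutation of `H` along `π` is a braided Hopf algebra. -/
theorem transmutation_isBraidedHopf : (transmutation π R).IsBraidedHopf R := by
  have e : ∀ x a, (R.bosonizationEquiv π).symm (R.bowtieLeft π x *
      incl π (R.bowtieLeft π) (R.bowtieRight π) a) = x ⊗ₜ a := fun x a => by
    rw [LinearEquiv.symm_apply_eq, bosonizationEquiv_apply, toBosonized_tmul]
  -- P and p are ε ⊗ id and id ⊗ ε in the coordinates x ⊗ a of the product i(x)ι(a).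
  refine (R.bowtie_exchangeRel π).transmutation_isBraidedHopf
    (P := (TensorProduct.lid k H).toLinearMap ∘ₗ (counit (R := k) (A := K)).rTensor H ∘ₗ
      (R.bosonizationEquiv π).symm.toLinearMap)
    (p := (TensorProduct.rid k K).toLinearMap ∘ₗ (counit (R := k) (A := H)).lTensor K ∘ₗ
      (R.bosonizationEquiv π).symm.toLinearMap) (fun x a => ?_) (fun x a => ?_)
  · simp [e]
  · simp [e]

theorem bosonizationEquiv_mul (s t : K ⊗[k] H) : R.bosonizationEquiv π
    (((transmutation π R).bosonization R).mul (s ⊗ₜ t)) =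
      R.bosonizationEquiv π s * R.bosonizationEquiv π t := by
  simp only [bosonizationEquiv_apply, (R.bowtie_exchangeRel π).toBosonized_mul]

theorem comul_bosonizationEquiv (t : K ⊗[k] H) : comul (R := k) (R.bosonizationEquiv π t) =
    TensorProduct.map (R.bosonizationEquiv π : _ →ₗ[k] R.Bowtie π)
      (R.bosonizationEquiv π : _ →ₗ[k] R.Bowtie π)
      (((transmutation π R).bosonization R).comul t) := by
  have e : (R.bosonizationEquiv π : _ →ₗ[k] R.Bowtie π) =
    toBosonized π (R.bowtieLeft π) (R.bowtieRight π) :=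
    LinearMap.ext (R.bosonizationEquiv_apply π)
  rw [e, bosonizationEquiv_apply, comul_toBosonized]

theorem counit_bosonizationEquiv (t : K ⊗[k] H) : counit (R := k) (R.bosonizationEquiv π t) =
    ((transmutation π R).bosonization R).counit t := by
  rw [bosonizationEquiv_apply, counit_toBosonized]

theorem antipode_bosonizationEquiv (t : K ⊗[k] H) :
    HopfAlgebra.antipode k (R.bosonizationEquiv π t) =
      R.bosonizationEquiv π (((transmutation π R).bosonization R).antipode t) := by
  rw [bosonizationEquiv_apply, bosonizationEquiv_apply,
    (R.bowtie_exchangeRel π).antipode_toBosonized]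

theorem bosonization_isHopf : ((transmutation π R).bosonization R).IsHopf :=
  HopfData.isHopf_of_equiv _ (R.bosonizationEquiv π) (R.bosonizationEquiv_mul π)
    ((R.bosonizationEquiv_apply π _).trans toBosonized_one) (R.comul_bosonizationEquiv π)
    (R.counit_bosonizationEquiv π) (R.antipode_bosonizationEquiv π)

end Coquasitriangular

theorem mainTheorem2 {K H : Type*} [Ring K] [HopfAlgebra ℂ K] [Ring H] [HopfAlgebra ℂ H]
    (π : H →ₐc[ℂ] K) (R : Coquasitriangular ℂ K) :
    (transmutation π R).IsBraidedHopf R ∧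
    ∃ (S : K ⊗[ℂ] H →ₗ[ℂ] K ⊗[ℂ] H)
      (hB : (bowtie π R S).IsHopf)
      (hA : ((transmutation π R).bosonization R).IsHopf)
      (Φ : (bowtie π R S).Carrier hB ≃ₐc[ℂ] ((transmutation π R).bosonization R).Carrier hA),
      (∀ (x : K) (h : H), Φ ((bowtie π R S).toCarrier hB (x ⊗ₜ h)) =
        ((transmutation π R).bosonization R).toCarrier hA
          (TensorProduct.map (LinearMap.mulLeft ℂ x ∘ₗ (π : H →ₗ[ℂ] K)) LinearMap.id
            (Coalgebra.comul (R := ℂ) h))) ∧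
      ∀ b, Φ (HopfAlgebra.antipode ℂ b) = HopfAlgebra.antipode ℂ (Φ b) := by
  -- The structure was verified for x # h ↦ xπ(S(h₁)) ⊗ h₂; the map of the theorem is its inverse,
  -- the shear by π.
  let Φ := (((transmutation π R).bosonization R).carrierEquiv (R.bosonization_isHopf π)
    (R.bosonizationEquiv π) (R.bosonizationEquiv_mul π) (R.comul_bosonizationEquiv π)
    (R.counit_bosonizationEquiv π)).symm
  exact ⟨R.transmutation_isBraidedHopf π, R.bowtieAntipode π, R.bowtie_isHopf π,
    R.bosonization_isHopf π, Φ, R.bosonizationEquiv_symm_toBowtie π, Φ.map_antipode⟩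

end
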